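/- **The game.** Fix integers $n,f,m,T$ and reals $\epsilon,c>0$. There are $n$ processes, all initially good, with weights $w_{i,0}=1$. A computationally unbounded adaptive adversary, who sees everything except future coin flips, may corrupt up to $f$ processes at any times; $G$ and $B$ denote the currently good and bad processes. The processes generate a sequence of $m\times n$ blackboards $\mathsf{BB}_1,\mathsf{BB}_2,\dots$, where process $i$ fills column $i$ row by row with values in $\{-1,1\}$; each value is a fresh fair coin flip if $i$ is good and arbitrary if $i$ is bad. The adversary schedules the writes and may declare $\mathsf{BB}_t$ complete once at least $n-f$ of its columns are full (the remaining cells stay blank). Then every process $p$ gets a view $\mathsf{BB}^{(p,t)}$ of $(\mathsf{BB}_1,\dots,\mathsf{BB}_t)$, chosen by the adversary, in which the values of at most $f$ cells are replaced by blanks, each of them the last cell written so far by its process. Put $X_{\max}=\sqrt{cm\ln n}$, $\alpha_T=m\bigl(T+\sqrt{T(c\ln n)^3}\bigr)$, $\beta_T=m\sqrt{T(c\ln n)^3}$, $w_{\min}=\sqrt{n\ln n}/T$. Epoch $k\ge1$ consists of the blackboards $(k-1)T+1,\dots,kT$ and uses the weights $(w_{i,k-1})_i$. At its end, let $X_i^{(p)}(t)$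 be the sum of column $i$ of blackboard $t$ in the view $\mathsf{BB}^{(p,kT)}$, mapped to the nearest point of $[-X_{\max},X_{\max}]$, and, with sums over the iterations $t$ of epoch $k$, $$\mathrm{dev}^{(p)}(i)=\sum_t\bigl(w_{i,k-1}X^{(p)}_i(t)\bigr)^2,\qquad \mathrm{corr}^{(p)}(i,j)=\sum_t w_{i,k-1}w_{j,k-1}X^{(p)}_i(t)X^{(p)}_j(t).$$ Process $p$ forms the complete graph with self-loops on $[n]$ with vertex capacities $c_V(i)=w_{i,k-1}$ and edge capacities $$c_E(i,i)=\tfrac{16}{\epsilon f\alpha_T}\max\{0,\mathrm{dev}^{(p)}(i)-w_{i,k-1}^2\alpha_T\},\qquad c_E(i,j)=\tfrac{16}{\epsilon f\alpha_T}\cdot2\max\{0,\mathrm{corr}^{(p)}(i,j)-w_{i,k-1}w_{j,k-1}\beta_T\}\ (i\ne j).$$ It computes the fractional matching $\mu^{(p)}_k$ by the Rising Tide algorithm: start with $\mu=0$ and raise $\mu$ at the same rate on all edges of positive capacity, freezing an edge $(i,j)$ as soon as $\mu(i,j)=c_E(i,j)$ or one of its endpoints $v$ is saturated, i.e. $\sum_{j}\mu(v,j)=c_V(v)$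 (self-loops counted once). It sets $w_{i,k}^{(p)}=w_{i,k-1}-\sum_j\mu_k^{(p)}(i,j)$. The weights of epoch $k+1$ are $w_{i,k}=w_{i,k}^{(i)}$ if $w_{i,k}^{(i)}>w_{\min}$, and $w_{i,k}=0$ otherwise. **Lemma (Maintaining Invariant 1).** There are absolute constants $a,c_0>0$ such that for every $c\ge c_0$ and all constants $m_1,m_2,T_1,T_2>0$ there is $n_0$ such that the following holds for all $n\ge n_0$ and all $f,m,T$ and $\epsilon>0$ with $n=(4+\epsilon)f$, $m_1\frac{n}{\epsilon^2}\le m\le m_2\frac{n}{\epsilon^2}$ and $T_1\frac{n^2\ln^3n}{\epsilon^2}\le T\le T_2\frac{n^2\ln^3n}{\epsilon^2}$ (that is, $m=\Theta(n/\epsilon^2)$ and $T=\Theta(n^2\log^3n/\epsilon^2)$). Against every adversary, with probability at least $1-n^{-ac}$, at every point in every epoch $k$ with $1\le k\le 2.5f$, $$\sum_{i\in G}(1-w_{i,k-1})\le\sum_{i\in B}(1-w_{i,k-1})+\frac{\epsilon^2}{\sqrt n}(k-1),$$ and Invariant 1 holds: $$\sum_{i\in G}(1-w_{i,k-1})\le\sum_{i\in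 B}(1-w_{i,k-1})+\frac{\epsilon^2f}{8}.$$ -/

import Mathlib

open scoped BigOperators

noncomputable section

namespace CoinGame

/-! ### Fractional matchings and the Rising Tide algorithm

A vertex- and edge-capacitated complete undirected graph with self-loops on `V` is given by
`cV : V → ℝ` and a symmetric `cE : V → V → ℝ`.  A fractional matching is a function
`μ : V → V → ℝ`; in `∑ j, μ i j` a self-loop counts once. -/

section RisingTide

variable {V : Type} [Fintype V]

/-- `μ` is a feasible fractional matching for the capacities `cV`, `cE`. -/
def IsFeasible (cV : V → ℝ) (cE : V → V → ℝ) (μ : V → V → ℝ) : Prop :=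
  (∀ i j, 0 ≤ μ i j ∧ μ i j ≤ cE i j) ∧ ∀ i, ∑ j, μ i j ≤ cV i

/-- The vertex `i` is saturated. -/
def VertexSaturated (cV : V → ℝ) (μ : V → V → ℝ) (i : V) : Prop :=
  ∑ j, μ i j = cV i

/-- The edge `(i, j)` is saturated. -/
def EdgeSaturated (cE : V → V → ℝ) (μ : V → V → ℝ) (i j : V) : Prop :=
  μ i j = cE i j

open Classical in
/-- Raise `μ` by `x` on all edges of the working set `E`. -/
def raiseOn (E : Finset (V × V)) (μ : V → V → ℝ) (x : ℝ) : V → V → ℝ :=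
  fun i j => μ i j + if (i, j) ∈ E then x else 0

/-- The largest amount by which `μ` can be raised on `E` while it stays feasible.
(It is `0` if an endpoint of an edge of `E` has capacity `0` from the start.) -/
def maxIncrement (cV : V → ℝ) (cE : V → V → ℝ) (E : Finset (V × V)) (μ : V → V → ℝ) : ℝ :=
  sSup {x : ℝ | 0 ≤ x ∧ IsFeasible cV cE (raiseOn E μ x)}

open Classical in
/-- One round of the loop: raise `μ` as much as possible in lockstep on the working set, then
drop from the working set the edges that are saturated or have a saturated endpoint.
Nothing changes when the working set is empty. -/
def tideStep (cV : V → ℝ) (cE : V → V → ℝ) (s : Finset (V × V) × (V → V → ℝ)) :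
    Finset (V × V) × (V → V → ℝ) :=
  let μ' := raiseOn s.1 s.2 (maxIncrement cV cE s.1 s.2)
  (s.1.filter fun e =>
      ¬ (VertexSaturated cV μ' e.1 ∨ VertexSaturated cV μ' e.2 ∨ EdgeSaturated cE μ' e.1 e.2),
    μ')

open Classical in
/-- The Rising Tide algorithm.  Every round that starts with a nonempty working set removes at
least one edge from it, so the loop has ended after `|V × V|` rounds. -/
def risingTide (cV : V → ℝ) (cE : V → V → ℝ) : V → V → ℝ :=
  ((tideStep cV cE)^[Fintype.card (V × V)]
    (Finset.univ.filter fun e : V × V => 0 < cE e.1 e.2, fun _ _ => 0)).2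

end RisingTide

/-! ### The parameters of the game -/

/-- Number of processes `n`, bound `f` on the corruptions, number `m` of rows of a blackboard,
number `T` of iterations (blackboards) of an epoch, the slack `ε`, and the constant `c`. -/
structure Params where
  n : ℕ
  f : ℕ
  m : ℕ
  T : ℕ
  ε : ℝ
  c : ℝ

namespace Params

variable (P : Params)

/-- `X_max = √(c m ln n)`. -/
def Xmax : ℝ := √(P.c * P.m * Real.log P.n)

/-- `α_T = m (T + √(T (c ln n)³))`. -/
def alphaT : ℝ := P.m * (P.T + √(P.T * (P.c * Real.log P.n) ^ 3))

/-- `β_T = m √(T (c ln n)³)`. -/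
def betaT : ℝ := P.m * √(P.T * (P.c * Real.log P.n) ^ 3)

/-- `w_min = √(n ln n) / T`. -/
def wmin : ℝ := √(P.n * Real.log P.n) / P.T

end Params

/-! ### Scores, excess graph and weight update -/

/-- The sum of the `±1` values of a column, mapped to the nearest point of
`[-X_max, X_max]`. -/
def columnValue (P : Params) (col : List Bool) : ℝ :=
  max (-P.Xmax) (min P.Xmax (col.map fun b => if b then (1 : ℝ) else -1).sum)

/-- `dev(i)`, over the iterations in `I`, for the weights `w` and the column values `X`. -/
def dev {V : Type} (I : Finset ℕ) (w : V → ℝ) (X : ℕ → V → ℝ) (i : V) : ℝ :=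
  ∑ t ∈ I, (w i * X t i) ^ 2

/-- `corr(i, j)`, over the iterations in `I`, for the weights `w` and the column values `X`. -/
def corr {V : Type} (I : Finset ℕ) (w : V → ℝ) (X : ℕ → V → ℝ) (i j : V) : ℝ :=
  ∑ t ∈ I, w i * w j * X t i * X t j

/-- Edge capacities of the excess graph (its vertex capacities are the weights `w`). -/
def excessCap (P : Params) (I : Finset ℕ) (w : Fin P.n → ℝ) (X : ℕ → Fin P.n → ℝ)
    (i j : Fin P.n) : ℝ :=
  if i = j then
    16 / (P.ε * P.f * P.alphaT) * max 0 (dev I w X i - w i ^ 2 * P.alphaT)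
  else
    16 / (P.ε * P.f * P.alphaT) * (2 * max 0 (corr I w X i j - w i * w j * P.betaT))

/-- The weight vector that a process computes at the end of an epoch with iterations `I` from
the weights `w` used in it and from its own view `X` of the column values. -/
def localWeight (P : Params) (I : Finset ℕ) (w : Fin P.n → ℝ) (X : ℕ → Fin P.n → ℝ)
    (i : Fin P.n) : ℝ :=
  w i - ∑ j, risingTide w (excessCap P I w X) i j

/-- The consensus weight of `i`: the weight of `i` in the vector computed by `i` itself from its
own view `X i`, rounded down to `0` unless it exceeds `w_min`. -/
def consensusWeight (P : Params) (I : Finset ℕ) (w : Fin P.n → ℝ)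
    (X : Fin P.n → ℕ → Fin P.n → ℝ) (i : Fin P.n) : ℝ :=
  if P.wmin < localWeight P I w (X i) i then localWeight P I w (X i) i else 0

/-! ### The coin-flipping game on an iterated blackboard -/

/-- The moves of the adversary. -/
inductive Move (n : ℕ) where
  /-- do nothing -/
  | idle
  /-- let the good process `i` flip its next coin and write it to the current blackboard -/
  | flip (i : Fin n)
  /-- let the bad process `i` write the value `b` to the current blackboard -/
  | write (i : Fin n) (b : Bool)
  /-- corrupt the process `i` -/
  | corrupt (i : Fin n)
  /-- complete the current blackboard; process `p` forms its view of the history, in which the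
  last value written by `i` is replaced by a blank for every `i ∈ hidden p` -/
  | complete (hidden : Fin n → Finset (Fin n))

/-- A state of the game. -/
structure State (P : Params) where
  /-- the number of completed blackboards; blackboard `t` is the one under construction -/
  t : ℕ
  /-- `board τ i` lists the values written so far by process `i` to its column of blackboard `τ`,
  row by row (`true` is `1`, `false` is `-1`); the remaining rows of the column are blank -/
  board : ℕ → Fin P.n → List Bool
  /-- the corrupted processes -/
  bad : Finset (Fin P.n)
  /-- the consensus weights used in the current epoch -/
  weight : Fin P.n → ℝ

namespace State

variable {P : Params}

/-- Nothing is written, all processes are good, all weights are `1`. -/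
def init (P : Params) : State P where
  t := 0
  board := fun _ _ => []
  bad := ∅
  weight := fun _ => 1

/-- The good processes. -/
def good (S : State P) : Finset (Fin P.n) := S.badᶜ

/-- The index, starting at `1`, of the current epoch. -/
def epoch (S : State P) : ℕ := S.t / P.T + 1

/-- Process `i` writes the value `b` to the next row of its column of the current blackboard. -/
def append (S : State P) (i : Fin P.n) (b : Bool) : State P :=
  { S with
    board := fun τ j => if τ = S.t ∧ j = i then S.board τ j ++ [b] else S.board τ j }

/-- The full columns of the current blackboard. -/
def fullColumns (S : State P) : Finset (Fin P.n) :=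
  Finset.univ.filter fun i => (S.board S.t i).length = P.m

open Classical in
/-- Column `i` of blackboard `τ` in a view of the history in which, for each `i ∈ hidden`, the last
value written by `i` (to whichever blackboard) is replaced by a blank. -/
def viewColumn (S : State P) (hidden : Finset (Fin P.n)) (τ : ℕ) (i : Fin P.n) : List Bool :=
  if i ∈ hidden ∧ ∀ τ' > τ, S.board τ' i = [] then (S.board τ i).dropLast else S.board τ i

/-- The current blackboard is completed.  If it is the last one of its epoch, the weights are
updated from the views of the `T` blackboards of that epoch. -/
def finish (S : State P) (hidden : Fin P.n → Finset (Fin P.n)) : State P :=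
  { S with
    t := S.t + 1
    weight :=
      if P.T ∣ S.t + 1 then
        consensusWeight P (Finset.Ico (S.t + 1 - P.T) (S.t + 1)) S.weight
          fun p τ i => columnValue P (S.viewColumn (hidden p) τ i)
      else S.weight }

/-- The effect of a move, where `coin` is the coin flipped if a good process gets to flip one.
A move that violates the rules has no effect.  The rules: a column has `m` rows; good processes
write coin flips, bad ones arbitrary values; at most `f` processes get corrupted; a blackboard can be
completed only if at least `n - f` of its columns are full, and every view of the history differs
from the true one in at most `f` cells, each of them the last one written by its process. -/
def step (S : State P) (coin : Bool) : Move P.n → State P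
  | .idle => S
  | .flip i => if i ∉ S.bad ∧ (S.board S.t i).length < P.m then S.append i coin else S
  | .write i b => if i ∈ S.bad ∧ (S.board S.t i).length < P.m then S.append i b else S
  | .corrupt i => if S.bad.card < P.f then { S with bad := insert i S.bad } else S
  | .complete hidden =>
      if P.n ≤ S.fullColumns.card + P.f ∧ ∀ p, (hidden p).card ≤ P.f then S.finish hidden else S

/-- The total weight lost by the good processes is at most the total weight lost by the bad ones
plus `slack`. -/
def WeightLossBound (S : State P) (slack : ℝ) : Prop :=
  ∑ i ∈ S.good, (1 - S.weight i) ≤ ∑ i ∈ S.bad, (1 - S.weight i) + slack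

/-- The invariant on the weights, with additive slack `ε² f / 8`. -/
def WeightInvariant (S : State P) : Prop :=
  S.WeightLossBound (P.ε ^ 2 * P.f / 8)

end State

/-- An adaptive, full-information adversary: its next move is a function of all past coins (which,
with its own past moves, determine the whole history). -/
abbrev Adversary (P : Params) : Type := List Bool → Move P.n

/-- The state after `s` moves, where `ω s` is the coin available to the move number `s`; the
adversary chooses that move knowing only the earlier coins. -/
def play (P : Params) (adv : Adversary P) (ω : ℕ → Bool) : ℕ → State P
  | 0 => State.init P
  | s + 1 => (play P adv ω s).step (ω s) (adv (List.ofFn fun r : Fin s => ω r))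

/-- The law of a sequence of independent fair coins. -/
def coinMeasure : MeasureTheory.Measure (ℕ → Bool) :=
  MeasureTheory.Measure.infinitePi fun _ => (PMF.uniformOfFintype Bool).toMeasure

end CoinGame

end

/-! Suppose first that all processes use the true blackboards. If neither a pair of good processes
nor a good process with itself has positive excess, the good processes form an independent set of
the excess graph. Every bit of weight that the matching takes from a good vertex is then also taken
from a bad one, so the good processes lose at most what the bad ones lose (`sum_load_le`).

The actual update deviates in two ways. Each process uses its own view, but the loads of Rising Tide
are Lipschitz in the edge capacities (`sum_abs_load_sub_le`), and a view perturbs at most `f`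
columns, each by at most `1` in total. Rounding costs at most `w_min` per process. For the given
orders of `m` and `T`, both errors together are at most `ε² / √n` per epoch (`epochSlack_le`). A
corruption only moves a nonnegative loss to the bad side. Over `2.5 f` epochs the error stays below
`ε² f / 8` because `√n ≥ 20`.

Independence holds with high probability by exponential supermartingales. Their compensators count
the coins actually written, so the adversary's schedule is irrelevant. They are set to `0` when one
of their processes is corrupted, so they control whichever processes are still good when the epoch
ends, although that set is chosen adaptively. One family bounds every column sum by `X_max` at all
times. The other, stopped once a partial column sum exceeds `X_max`, bounds the sum of `X_i X_j`
over an epoch, since one coin then changes the centred product by at most `X_max` (`2 X_max` if `i =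
j`). All of them, scaled so that a violation makes one term at least `1`, are added into one
potential that starts below `n ^ (-c / 4)`; Ville's inequality concludes. -/

open scoped BigOperators

noncomputable section

namespace CoinGame

/-! ### Rising Tide: closed form, symmetry and Lipschitz continuity -/

section RisingTideAnalysis

open Filter Topology

variable {V : Type}

theorem raiseOn_of_mem {E : Finset (V × V)} {u v : V} (h : (u, v) ∈ E) (μ : V → V → ℝ) (x : ℝ) :
    raiseOn E μ x u v = μ u v + x := by
  simp [raiseOn, h]

theorem raiseOn_of_notMem {E : Finset (V × V)} {u v : V} (h : (u, v) ∉ E) (μ : V → V → ℝ)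
    (x : ℝ) : raiseOn E μ x u v = μ u v := by
  simp [raiseOn, h]

theorem raiseOn_zero (E : Finset (V × V)) (μ : V → V → ℝ) : raiseOn E μ 0 = μ := by
  ext u v
  simp [raiseOn]

theorem raiseOn_add (E : Finset (V × V)) (μ : V → V → ℝ) (x y : ℝ) :
    raiseOn E μ (x + y) = raiseOn E (raiseOn E μ x) y := by
  ext u v
  by_cases h : (u, v) ∈ E
  · simp [raiseOn, h, add_assoc]
  · simp [raiseOn, h]

theorem le_raiseOn (E : Finset (V × V)) (μ : V → V → ℝ) {x : ℝ} (hx : 0 ≤ x) (u v : V) :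
    μ u v ≤ raiseOn E μ x u v := by
  by_cases h : (u, v) ∈ E
  · rw [raiseOn_of_mem h]; linarith
  · rw [raiseOn_of_notMem h]

theorem continuous_raiseOn (E : Finset (V × V)) (μ : V → V → ℝ) (u v : V) :
    Continuous fun x => raiseOn E μ x u v := by
  by_cases h : (u, v) ∈ E
  · simp only [raiseOn_of_mem h]; fun_prop
  · simp only [raiseOn_of_notMem h]; fun_prop

variable [Fintype V]

theorem bddAbove_increments {cV : V → ℝ} {cE : V → V → ℝ} {E : Finset (V × V)} {μ : V → V → ℝ}
    (hE : E.Nonempty) : BddAbove {x : ℝ | 0 ≤ x ∧ IsFeasible cV cE (raiseOn E μ x)} := by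
  obtain ⟨⟨u, v⟩, h⟩ := hE
  refine ⟨cE u v - μ u v, fun x hx => ?_⟩
  have := (hx.2.1 u v).2
  rw [raiseOn_of_mem h] at this
  linarith

theorem isClosed_increments (cV : V → ℝ) (cE : V → V → ℝ) (E : Finset (V × V)) (μ : V → V → ℝ) :
    IsClosed {x : ℝ | 0 ≤ x ∧ IsFeasible cV cE (raiseOn E μ x)} := by
  have hc := continuous_raiseOn E μ
  simp only [IsFeasible, Set.ofPred_and, Set.ofPred_forall]
  refine (isClosed_le continuous_const continuous_id).inter (IsClosed.inter ?_ ?_)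
  · exact isClosed_iInter fun i => isClosed_iInter fun j =>
      (isClosed_le continuous_const (hc i j)).inter (isClosed_le (hc i j) continuous_const)
  · exact isClosed_iInter fun i =>
      isClosed_le (continuous_finsetSum _ fun j _ => hc i j) continuous_const

theorem maxIncrement_nonneg (cV : V → ℝ) (cE : V → V → ℝ) (E : Finset (V × V)) (μ : V → V → ℝ) :
    0 ≤ maxIncrement cV cE E μ :=
  Real.sSup_nonneg fun _ hx => hx.1

theorem isFeasible_raiseOn_maxIncrement {cV : V → ℝ} {cE : V → V → ℝ} {E : Finset (V × V)}
    {μ : V → V → ℝ} (h : IsFeasible cV cE μ) :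
    IsFeasible cV cE (raiseOn E μ (maxIncrement cV cE E μ)) := by
  -- With no active edge the increments are unbounded and their `sSup` is the default value `0`; any
  -- value would do, since nothing is raised.
  rcases E.eq_empty_or_nonempty with rfl | hE
  · convert h using 1
    ext u v
    exact raiseOn_of_notMem (by simp) _ _
  · exact ((isClosed_increments cV cE E μ).csSup_mem ⟨0, le_rfl, by rwa [raiseOn_zero]⟩
      (bddAbove_increments hE)).2

/-- The state of the Rising Tide algorithm at water level `x`, where `τ u` is the level at which
the vertex `u` got saturated, or `x` if it is not saturated yet. -/
structure TideInvariant (cV : V → ℝ) (cE : V → V → ℝ) (x : ℝ) (τ : V → ℝ)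
    (s : Finset (V × V) × (V → V → ℝ)) : Prop where
  feasible : IsFeasible cV cE s.2
  le_level : ∀ u, τ u ≤ x
  eq_level : ∀ u, ¬ VertexSaturated cV s.2 u → τ u = x
  eq_min : ∀ u v, s.2 u v = min (cE u v) (min (τ u) (τ v))
  symm : ∀ u v, (u, v) ∈ s.1 → (v, u) ∈ s.1
  active : ∀ u v, (u, v) ∈ s.1 → s.2 u v = x
  frozen : ∀ u v, (u, v) ∉ s.1 →
    VertexSaturated cV s.2 u ∨ VertexSaturated cV s.2 v ∨ EdgeSaturated cE s.2 u v

open Classical in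
/-- Raising the unsaturated vertices to a higher level keeps the formula for the value of a frozen
edge. -/
theorem TideInvariant.eq_min_raise {cV : V → ℝ} {cE : V → V → ℝ} {x : ℝ} {τ : V → ℝ}
    {s : Finset (V × V) × (V → V → ℝ)} (h : TideInvariant cV cE x τ s) {x' : ℝ} (hx : x ≤ x')
    {u v : V} (huv : (u, v) ∉ s.1) :
    s.2 u v = min (cE u v) (min (if VertexSaturated cV s.2 u then τ u else x')
      (if VertexSaturated cV s.2 v then τ v else x')) := by
  have hmin := h.eq_min u v
  have hu := h.le_level u
  have hv := h.le_level v
  have hu' := h.eq_level u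
  have hv' := h.eq_level v
  have hfr := h.frozen u v huv
  by_cases su : VertexSaturated cV s.2 u <;> by_cases sv : VertexSaturated cV s.2 v <;>
    simp only [su, sv, if_true, if_false, not_true, not_false_iff, EdgeSaturated, true_or,
      false_or, forall_const, IsEmpty.forall_iff] at * <;> grind

open Classical in
theorem mem_tideStep {cV : V → ℝ} {cE : V → V → ℝ} {s : Finset (V × V) × (V → V → ℝ)} {u v : V} :
    (u, v) ∈ (tideStep cV cE s).1 ↔ (u, v) ∈ s.1 ∧
      ¬ (VertexSaturated cV (tideStep cV cE s).2 u ∨ VertexSaturated cV (tideStep cV cE s).2 v ∨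
        EdgeSaturated cE (tideStep cV cE s).2 u v) :=
  Finset.mem_filter

/-- The water level rises by the increment of the round, and so does the level of each vertex that
was unsaturated before it. A vertex that was already saturated keeps its level. -/
theorem TideInvariant.step {cV : V → ℝ} {cE : V → V → ℝ} {x : ℝ} {τ : V → ℝ}
    {s : Finset (V × V) × (V → V → ℝ)} (hc : ∀ u v, cE u v = cE v u)
    (h : TideInvariant cV cE x τ s) :
    ∃ x' τ', TideInvariant cV cE x' τ' (tideStep cV cE s) := by
  classical
  set y := maxIncrement cV cE s.1 s.2 with hy
  have hy0 : 0 ≤ y := maxIncrement_nonneg _ _ _ _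
  have hfeas : IsFeasible cV cE (raiseOn s.1 s.2 y) := isFeasible_raiseOn_maxIncrement h.feasible
  have hsat : ∀ u, VertexSaturated cV s.2 u → VertexSaturated cV (raiseOn s.1 s.2 y) u := by
    intro u hu
    refine le_antisymm (hfeas.2 u) ?_
    rw [← hu]
    exact Finset.sum_le_sum fun v _ => le_raiseOn _ _ hy0 u v
  -- An active edge can have a saturated endpoint, for instance a vertex of capacity `0` at the
  -- start. The increment is then `0`, so the formula survives.
  have hactive : ∀ u v, (u, v) ∈ s.1 → VertexSaturated cV s.2 u → y = 0 := by
    intro u v huv hu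
    have h1 : ∑ j, raiseOn s.1 s.2 y u j = ∑ j, s.2 u j := (hsat u hu).trans hu.symm
    have h2 := (Finset.sum_eq_sum_iff_of_le
      fun j _ => le_raiseOn s.1 s.2 hy0 u j).1 h1.symm v (Finset.mem_univ v)
    rw [raiseOn_of_mem huv] at h2
    linarith
  refine ⟨x + y, fun u => if VertexSaturated cV s.2 u then τ u else x + y, ?_⟩
  have hmin : ∀ u v, raiseOn s.1 s.2 y u v = min (cE u v)
      (min (if VertexSaturated cV s.2 u then τ u else x + y)
        (if VertexSaturated cV s.2 v then τ v else x + y)) := by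
    intro u v
    by_cases huv : (u, v) ∈ s.1
    · have h1 := (hfeas.1 u v).2
      have h2 := h.eq_min u v
      have h3 := h.active u v huv
      have h4 := h.eq_level u
      have h5 := h.eq_level v
      have h6 := hactive u v huv
      have h7 := hactive v u (h.symm u v huv)
      have h8 := raiseOn_of_mem huv s.2 y
      grind
    · rw [raiseOn_of_notMem huv]
      exact h.eq_min_raise (by linarith) huv
  refine ⟨hfeas, fun u => ?_, fun u hu => ?_, hmin, fun u v huv => ?_, fun u v huv => ?_,
    fun u v huv => ?_⟩
  · have := h.le_level u
    split_ifs <;> linarith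
  · exact if_neg fun h' => hu (hsat u h')
  · rw [mem_tideStep] at huv ⊢
    have hs : raiseOn s.1 s.2 y v u = raiseOn s.1 s.2 y u v := by
      rw [hmin, hmin, hc v u, min_comm (ite _ _ _)]
    have hs' : EdgeSaturated cE (tideStep cV cE s).2 v u ↔
        EdgeSaturated cE (tideStep cV cE s).2 u v := by
      change raiseOn s.1 s.2 y v u = cE v u ↔ raiseOn s.1 s.2 y u v = cE u v
      rw [hs, hc v u]
    exact ⟨h.symm u v huv.1, by rw [hs']; tauto⟩
  · rw [mem_tideStep] at huv
    change raiseOn s.1 s.2 y u v = x + y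
    rw [raiseOn_of_mem huv.1, h.active u v huv.1]
  · change VertexSaturated cV (raiseOn s.1 s.2 y) u ∨ VertexSaturated cV (raiseOn s.1 s.2 y) v ∨
      EdgeSaturated cE (raiseOn s.1 s.2 y) u v
    by_cases huv' : (u, v) ∈ s.1
    · rw [mem_tideStep, not_and, not_not] at huv
      exact huv huv'
    · have := h.frozen u v huv'
      simp only [EdgeSaturated, raiseOn_of_notMem huv'] at this ⊢
      exact this.imp (hsat u) (Or.imp_left (hsat v))

/-- A round that starts with a nonempty working set removes an edge from it. -/
theorem card_tideStep_lt {cV : V → ℝ} {cE : V → V → ℝ} {s : Finset (V × V) × (V → V → ℝ)}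
    (h : IsFeasible cV cE s.2) (hne : s.1.Nonempty) :
    (tideStep cV cE s).1.card < s.1.card := by
  classical
  refine Finset.card_lt_card ((Finset.filter_ssubset).2 ?_)
  set y := maxIncrement cV cE s.1 s.2 with hy
  by_contra! hcon
  have hfeas : IsFeasible cV cE (raiseOn s.1 s.2 y) := isFeasible_raiseOn_maxIncrement h
  have hy0 : 0 ≤ y := maxIncrement_nonneg _ _ _ _
  -- If no edge is dropped, every constraint on an active edge or on its endpoints has room left. A
  -- further small raise is then feasible, contradicting maximality.
  have hev : ∀ᶠ δ in 𝓝[>] (0 : ℝ), IsFeasible cV cE (raiseOn s.1 (raiseOn s.1 s.2 y) δ) := by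
    have hc := continuous_raiseOn s.1 (raiseOn s.1 s.2 y)
    refine Filter.Eventually.and ?_ ?_
    · refine eventually_all.2 fun u => eventually_all.2 fun v => ?_
      by_cases huv : (u, v) ∈ s.1
      · have hlt : raiseOn s.1 (raiseOn s.1 s.2 y) 0 u v < cE u v := by
          rw [raiseOn_zero]
          exact lt_of_le_of_ne (hfeas.1 u v).2 (hcon (u, v) huv).2.2
        have h1 := ((hc u v).tendsto 0).eventually (gt_mem_nhds hlt)
        filter_upwards [h1.filter_mono nhdsWithin_le_nhds, self_mem_nhdsWithin] with δ h1 h2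
        exact ⟨(hfeas.1 u v).1.trans (le_raiseOn _ _ (le_of_lt h2) u v), h1.le⟩
      · simp only [raiseOn_of_notMem huv]
        have := hfeas.1 u v
        rw [raiseOn_of_notMem huv] at this
        exact Eventually.of_forall fun _ => this
    · refine eventually_all.2 fun u => ?_
      by_cases hu : ∃ v, (u, v) ∈ s.1
      · obtain ⟨v, huv⟩ := hu
        have hlt : ∑ j, raiseOn s.1 (raiseOn s.1 s.2 y) 0 u j < cV u := by
          rw [raiseOn_zero]
          exact lt_of_le_of_ne (hfeas.2 u) (hcon (u, v) huv).1
        have h1 := ((continuous_finsetSum Finset.univ fun j _ => hc u j).tendsto 0).eventually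
          (gt_mem_nhds hlt)
        filter_upwards [h1.filter_mono nhdsWithin_le_nhds] with δ h1
        exact h1.le
      · push Not at hu
        simp only [raiseOn_of_notMem (hu _)]
        have := hfeas.2 u
        simp only [raiseOn_of_notMem (hu _)] at this
        exact Eventually.of_forall fun _ => this
  obtain ⟨δ, hδ, hδ0⟩ := (hev.and self_mem_nhdsWithin).exists
  rw [← raiseOn_add] at hδ
  have hδ0 : 0 < δ := hδ0
  have := le_csSup (bddAbove_increments hne) ⟨by positivity, hδ⟩
  change y + δ ≤ y at this
  linarith

theorem exists_tideInvariant {cV : V → ℝ} {cE : V → V → ℝ} (hV : ∀ u, 0 ≤ cV u)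
    (hE : ∀ u v, 0 ≤ cE u v) (hc : ∀ u v, cE u v = cE v u) :
    ∃ x τ, TideInvariant cV cE x τ (∅, risingTide cV cE) := by
  classical
  set s₀ : Finset (V × V) × (V → V → ℝ) :=
    (Finset.univ.filter fun e : V × V => 0 < cE e.1 e.2, fun _ _ => 0) with hs₀
  have h₀ : TideInvariant cV cE 0 (fun _ => 0) s₀ := by
    refine ⟨⟨fun u v => ⟨le_rfl, hE u v⟩, fun u => by simpa [hs₀] using hV u⟩, fun _ => le_rfl,
      fun _ _ => rfl, fun u v => by simp [hs₀, hE u v], fun u v huv => ?_, fun _ _ _ => rfl,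
      fun u v huv => ?_⟩
    · simpa [hs₀, hc v u] using huv
    · refine Or.inr (Or.inr ?_)
      simp only [hs₀, Finset.mem_filter, Finset.mem_univ, true_and, not_lt] at huv
      exact le_antisymm (hE u v) huv
  have hiter : ∀ N, (∃ x τ, TideInvariant cV cE x τ ((tideStep cV cE)^[N] s₀)) ∧
      ((tideStep cV cE)^[N] s₀).1.card ≤ Fintype.card (V × V) - N := by
    intro N
    induction N with
    | zero => exact ⟨⟨_, _, h₀⟩, by simpa using Finset.card_le_univ s₀.1⟩
    | succ N ih =>
      obtain ⟨⟨x, τ, h⟩, hcard⟩ := ih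
      rw [Function.iterate_succ_apply']
      refine ⟨h.step hc, ?_⟩
      rcases Finset.eq_empty_or_nonempty ((tideStep cV cE)^[N] s₀).1 with h0 | hne
      · have : (tideStep cV cE ((tideStep cV cE)^[N] s₀)).1 = ∅ := by
          simp only [tideStep]
          rw [h0, Finset.filter_empty]
        simp [this]
      · have := card_tideStep_lt h.feasible hne
        omega
  obtain ⟨⟨x, τ, h⟩, hcard⟩ := hiter (Fintype.card (V × V))
  refine ⟨x, τ, ?_⟩
  rw [Nat.sub_self, Nat.le_zero, Finset.card_eq_zero] at hcard
  rw [← hcard]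
  exact h

theorem isFeasible_risingTide {cV : V → ℝ} {cE : V → V → ℝ} (hV : ∀ u, 0 ≤ cV u)
    (hE : ∀ u v, 0 ≤ cE u v) (hc : ∀ u v, cE u v = cE v u) :
    IsFeasible cV cE (risingTide cV cE) := by
  obtain ⟨x, τ, h⟩ := exists_tideInvariant hV hE hc
  exact h.feasible

theorem risingTide_symm {cV : V → ℝ} {cE : V → V → ℝ} (hV : ∀ u, 0 ≤ cV u)
    (hE : ∀ u v, 0 ≤ cE u v) (hc : ∀ u v, cE u v = cE v u) (u v : V) :
    risingTide cV cE u v = risingTide cV cE v u := by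
  obtain ⟨x, τ, h⟩ := exists_tideInvariant hV hE hc
  have h1 := h.eq_min u v
  have h2 := h.eq_min v u
  simp only at h1 h2
  rw [h1, h2, hc u v, min_comm (τ u)]

/-- The level of an unsaturated vertex plays no role and may be any `K` above the final water level.
This freedom gives two runs a common ceiling when they are compared. -/
theorem exists_risingTide_eq_min {cV : V → ℝ} {cE : V → V → ℝ} (hV : ∀ u, 0 ≤ cV u)
    (hE : ∀ u v, 0 ≤ cE u v) (hc : ∀ u v, cE u v = cE v u) :
    ∃ K₀, ∀ K, K₀ ≤ K → ∃ τ : V → ℝ, (∀ u, τ u ≤ K) ∧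
      (∀ u, τ u < K → VertexSaturated cV (risingTide cV cE) u) ∧
      ∀ u v, risingTide cV cE u v = min (cE u v) (min (τ u) (τ v)) := by
  classical
  obtain ⟨x, τ, h⟩ := exists_tideInvariant hV hE hc
  refine ⟨x, fun K hK => ⟨fun u => if VertexSaturated cV (risingTide cV cE) u then τ u else K,
    fun u => ?_, fun u hu => ?_, fun u v => h.eq_min_raise hK (by simp)⟩⟩
  · have := h.le_level u
    dsimp only
    split_ifs <;> linarith
  · by_contra h'
    simp [h'] at hu

/-- The vertex loads of Rising Tide are `1`-Lipschitz, in the `ℓ¹` norms, in the edge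
capacities. -/
theorem sum_abs_load_sub_le {cV : V → ℝ} {c c' : V → V → ℝ} (hV : ∀ u, 0 ≤ cV u)
    (h0 : ∀ u v, 0 ≤ c u v) (hc : ∀ u v, c u v = c v u)
    (h0' : ∀ u v, 0 ≤ c' u v) (hc' : ∀ u v, c' u v = c' v u) :
    ∑ u, |∑ v, risingTide cV c u v - ∑ v, risingTide cV c' u v| ≤
      ∑ u, ∑ v, |c u v - c' u v| := by
  classical
  obtain ⟨K₁, hK₁⟩ := exists_risingTide_eq_min hV h0 hc
  obtain ⟨K₂, hK₂⟩ := exists_risingTide_eq_min hV h0' hc'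
  obtain ⟨τ, hτK, hτ, hμ⟩ := hK₁ (max K₁ K₂) (le_max_left _ _)
  obtain ⟨τ', hτK', hτ', hμ'⟩ := hK₂ (max K₁ K₂) (le_max_right _ _)
  have hf := (isFeasible_risingTide hV h0 hc).2
  have hf' := (isFeasible_risingTide hV h0' hc').2
  set μ := risingTide cV c
  set μ' := risingTide cV c'
  -- A vertex with the lower level in one run is below the ceiling there, hence saturated, so its
  -- load in that run is the larger one. Load differences and level differences thus have opposite
  -- signs.
  have hsign : ∀ u, ∃ σ : ℝ, |∑ v, μ u v - ∑ v, μ' u v| = σ * (∑ v, μ u v - ∑ v, μ' u v) ∧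
      (σ = 1 ∧ τ u ≤ τ' u ∨ σ = -1 ∧ τ' u ≤ τ u) := by
    intro u
    rcases lt_trichotomy (τ u) (τ' u) with hlt | heq | hlt
    · have h1 : ∑ v, μ u v = cV u := hτ u (hlt.trans_le (hτK' u))
      exact ⟨1, by rw [one_mul, abs_of_nonneg]; linarith [hf' u], Or.inl ⟨rfl, hlt.le⟩⟩
    · rcases le_total 0 (∑ v, μ u v - ∑ v, μ' u v) with h | h
      · exact ⟨1, by rw [one_mul, abs_of_nonneg h], Or.inl ⟨rfl, heq.le⟩⟩
      · exact ⟨-1, by rw [abs_of_nonpos h]; ring, Or.inr ⟨rfl, heq.ge⟩⟩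
    · have h1 : ∑ v, μ' u v = cV u := hτ' u (hlt.trans_le (hτK u))
      exact ⟨-1, by rw [abs_of_nonpos] <;> linarith [hf u], Or.inr ⟨rfl, hlt.le⟩⟩
  choose σ hσ hσ' using hsign
  have hsymm : ∀ u v, μ u v = μ v u := risingTide_symm hV h0 hc
  have hsymm' : ∀ u v, μ' u v = μ' v u := risingTide_symm hV h0' hc'
  have hswap : ∑ u, ∑ v, σ u * (μ u v - μ' u v) = ∑ u, ∑ v, σ v * (μ u v - μ' u v) := by
    rw [Finset.sum_comm]
    exact Finset.sum_congr rfl fun u _ => Finset.sum_congr rfl fun v _ => by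
      rw [hsymm u v, hsymm' u v]
  -- For opposite signs the left side vanishes. For equal signs both levels move the same way, and
  -- `min` lets the flow move the other way only by as much as the capacity does.
  have hedge : ∀ u v, (σ u + σ v) * (μ u v - μ' u v) ≤ 2 * |c u v - c' u v| := by
    intro u v
    have h1 := hμ u v
    have h2 := hμ' u v
    have h3 := abs_nonneg (c u v - c' u v)
    have h4 := le_abs_self (c u v - c' u v)
    have h5 := neg_abs_le (c u v - c' u v)
    rcases hσ' u with ⟨su, hu⟩ | ⟨su, hu⟩ <;> rcases hσ' v with ⟨sv, hv⟩ | ⟨sv, hv⟩ <;>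
      rw [su, sv] <;> grind
  have hsum : ∑ u, |∑ v, μ u v - ∑ v, μ' u v| = ∑ u, ∑ v, σ u * (μ u v - μ' u v) := by
    refine Finset.sum_congr rfl fun u _ => ?_
    rw [hσ, ← Finset.sum_sub_distrib, Finset.mul_sum]
  have htwo : 2 * ∑ u, |∑ v, μ u v - ∑ v, μ' u v| ≤ 2 * ∑ u, ∑ v, |c u v - c' u v| := by
    calc 2 * ∑ u, |∑ v, μ u v - ∑ v, μ' u v|
        = ∑ u, ∑ v, σ u * (μ u v - μ' u v) + ∑ u, ∑ v, σ v * (μ u v - μ' u v) := by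
          rw [← hswap, hsum, two_mul]
      _ = ∑ u, ∑ v, (σ u + σ v) * (μ u v - μ' u v) := by
          simp only [← Finset.sum_add_distrib, add_mul]
      _ ≤ ∑ u, ∑ v, 2 * |c u v - c' u v| :=
          Finset.sum_le_sum fun u _ => Finset.sum_le_sum fun v _ => hedge u v
      _ = _ := by simp only [Finset.mul_sum]
  linarith

end RisingTideAnalysis

/-! ### Ville's inequality for fair coins -/

section Ville

open MeasureTheory
open scoped ENNReal

/-- The first `s` coins of a coin sequence. -/
abbrev coinPrefix (ω : ℕ → Bool) (s : ℕ) : List Bool := List.ofFn fun r : Fin s => ω r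

theorem coinPrefix_succ (ω : ℕ → Bool) (s : ℕ) :
    coinPrefix ω (s + 1) = coinPrefix ω s ++ [ω s] := by
  rw [coinPrefix, List.ofFn_succ_last]
  rfl

instance : IsProbabilityMeasure coinMeasure := by
  unfold coinMeasure; infer_instance

theorem coinMeasure_cylinder (l : List Bool) :
    coinMeasure {ω | coinPrefix ω l.length = l} = (2⁻¹ : ℝ≥0∞) ^ l.length := by
  have hset : {ω : ℕ → Bool | coinPrefix ω l.length = l} =
      Set.pi (Finset.range l.length : Finset ℕ) fun r => {l.getD r false} := by
    ext ω
    simp only [Set.mem_ofPred_eq, Set.mem_pi, Finset.coe_range, Set.mem_Iio,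
      Set.mem_singleton_iff, List.ext_get_iff, List.length_ofFn, true_and]
    constructor
    · intro h r hr
      simpa [hr] using h r (by simpa using hr) hr
    · intro h r hr hr'
      simpa [hr'] using h r hr'
  rw [hset, coinMeasure, Measure.infinitePi_pi _ (fun _ _ => by measurability)]
  simp

theorem coinMeasure_cylinder_append (l : List Bool) (b : Bool) :
    coinMeasure {ω | coinPrefix ω (l ++ [b]).length = l ++ [b]} =
      2⁻¹ * coinMeasure {ω | coinPrefix ω l.length = l} := by
  rw [coinMeasure_cylinder, coinMeasure_cylinder, List.length_append, List.length_singleton,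
    pow_succ']

/-- **Ville's inequality** for a nonnegative supermartingale adapted to the coins. -/
theorem coinMeasure_exists_one_le_le {M : List Bool → ℝ≥0∞}
    (hM : ∀ l, M (l ++ [true]) + M (l ++ [false]) ≤ 2 * M l) :
    coinMeasure {ω | ∃ s, 1 ≤ M (coinPrefix ω s)} ≤ M [] := by
  -- The inequality is localised to a cylinder and to a horizon of `N` further coins; induction on
  -- `N` splits the cylinder according to its next coin.
  have key : ∀ (N : ℕ) (l : List Bool),
      coinMeasure {ω | coinPrefix ω l.length = l ∧
        ∃ s, l.length ≤ s ∧ s ≤ l.length + N ∧ 1 ≤ M (coinPrefix ω s)} ≤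
      coinMeasure {ω | coinPrefix ω l.length = l} * M l := by
    intro N
    induction N with
    | zero =>
      intro l
      by_cases h1 : 1 ≤ M l
      · calc _ ≤ coinMeasure {ω | coinPrefix ω l.length = l} := measure_mono fun ω h => h.1
          _ ≤ _ := le_mul_of_one_le_right' h1
      · have : {ω : ℕ → Bool | coinPrefix ω l.length = l ∧
            ∃ s, l.length ≤ s ∧ s ≤ l.length + 0 ∧ 1 ≤ M (coinPrefix ω s)} = ∅ := by
          ext ω
          simp only [Set.mem_ofPred_eq, Set.mem_empty_iff_false, iff_false]
          rintro ⟨h, s, h2, h3, h4⟩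
          obtain rfl : s = l.length := by omega
          exact h1 (h ▸ h4)
        rw [this, measure_empty]
        exact zero_le
    | succ N ih =>
      intro l
      by_cases h1 : 1 ≤ M l
      · calc _ ≤ coinMeasure {ω | coinPrefix ω l.length = l} := measure_mono fun ω h => h.1
          _ ≤ _ := le_mul_of_one_le_right' h1
      set A : Bool → Set (ℕ → Bool) := fun b =>
        {ω | coinPrefix ω (l ++ [b]).length = l ++ [b] ∧
          ∃ s, (l ++ [b]).length ≤ s ∧ s ≤ (l ++ [b]).length + N ∧ 1 ≤ M (coinPrefix ω s)}
      have hsub : {ω : ℕ → Bool | coinPrefix ω l.length = l ∧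
          ∃ s, l.length ≤ s ∧ s ≤ l.length + (N + 1) ∧ 1 ≤ M (coinPrefix ω s)} ⊆
          A true ∪ A false := by
        rintro ω ⟨h, s, h2, h3, h4⟩
        have hne : s ≠ l.length := by
          rintro rfl
          exact h1 (h ▸ h4)
        have hmem : ω ∈ A (ω l.length) := by
          refine ⟨?_, s, ?_, ?_, h4⟩
          · rw [List.length_append, List.length_singleton, coinPrefix_succ, h]
          · simp; omega
          · simp; omega
        cases hb : ω l.length
        · exact Or.inr (hb ▸ hmem)
        · exact Or.inl (hb ▸ hmem)
      calc _ ≤ coinMeasure (A true) + coinMeasure (A false) :=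
            (measure_mono hsub).trans (measure_union_le _ _)
        _ ≤ _ := add_le_add (ih (l ++ [true])) (ih (l ++ [false]))
        _ = coinMeasure {ω | coinPrefix ω l.length = l} *
            (2⁻¹ * (M (l ++ [true]) + M (l ++ [false]))) := by
          rw [coinMeasure_cylinder_append, coinMeasure_cylinder_append]
          ring
        _ ≤ coinMeasure {ω | coinPrefix ω l.length = l} * (2⁻¹ * (2 * M l)) := by
          gcongr
          exact hM l
        _ = _ := by
          rw [← mul_assoc 2⁻¹, ENNReal.inv_mul_cancel (by simp) (by simp), one_mul]
  have hmono : Monotone fun N : ℕ => {ω : ℕ → Bool | ∃ s ≤ N, 1 ≤ M (coinPrefix ω s)} :=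
    fun N N' h ω ⟨s, hs, h1⟩ => ⟨s, hs.trans h, h1⟩
  have hunion : {ω : ℕ → Bool | ∃ s, 1 ≤ M (coinPrefix ω s)} =
      ⋃ N : ℕ, {ω : ℕ → Bool | ∃ s ≤ N, 1 ≤ M (coinPrefix ω s)} := by
    ext ω
    simp only [Set.mem_ofPred_eq, Set.mem_iUnion]
    exact ⟨fun ⟨s, h⟩ => ⟨s, s, le_rfl, h⟩, fun ⟨_, s, _, h⟩ => ⟨s, h⟩⟩
  rw [hunion, hmono.measure_iUnion]
  refine iSup_le fun N => ?_
  have := key N []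
  simpa [measure_univ] using this

end Ville

/-! ### Supermartingales of the game -/

section Play

open MeasureTheory
open scoped ENNReal

variable {P : Params}

theorem play_congr (adv : Adversary P) {ω ω' : ℕ → Bool} {s : ℕ}
    (h : ∀ r < s, ω r = ω' r) : play P adv ω s = play P adv ω' s := by
  induction s with
  | zero => rfl
  | succ s ih =>
    have hp : coinPrefix ω s = coinPrefix ω' s :=
      congrArg List.ofFn (funext fun r => h r (by omega))
    change State.step _ (ω s) (adv (coinPrefix ω s)) = State.step _ (ω' s) (adv (coinPrefix ω' s))
    rw [ih fun r hr => h r (by omega), hp, h s (by omega)]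

/-- The state reached with the coins `l`. -/
def replay (P : Params) (adv : Adversary P) (l : List Bool) : State P :=
  play P adv (fun r => l.getD r false) l.length

theorem replay_coinPrefix (adv : Adversary P) (ω : ℕ → Bool) (s : ℕ) :
    replay P adv (coinPrefix ω s) = play P adv ω s := by
  rw [replay, List.length_ofFn]
  exact play_congr adv fun r hr => by simp [hr]

theorem replay_append (adv : Adversary P) (l : List Bool) (b : Bool) :
    replay P adv (l ++ [b]) = (replay P adv l).step b (adv l) := by
  rw [replay, List.length_append, List.length_singleton]
  have h1 : play P adv (fun r => (l ++ [b]).getD r false) l.length = replay P adv l :=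
    play_congr adv fun r hr => by simp [List.getElem?_append_left hr]
  have h2 : coinPrefix (fun r => (l ++ [b]).getD r false) l.length = l := by
    apply List.ext_get <;> simp +contextual [List.getElem?_append_left]
  rw [play, h1]
  change State.step _ _ (adv (coinPrefix (fun r => (l ++ [b]).getD r false) l.length)) = _
  rw [h2]
  simp

/-- A function of the state that decreases in expectation whatever the adversary does. -/
def IsPotential (F : State P → ℝ) : Prop :=
  ∀ (S : State P) (mv : Move P.n), F (S.step true mv) + F (S.step false mv) ≤ 2 * F S

theorem coinMeasure_exists_one_le_potential (adv : Adversary P) {F : State P → ℝ}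
    (h0 : ∀ S, 0 ≤ F S) (hF : IsPotential F) :
    coinMeasure {ω | ∃ s, 1 ≤ F (play P adv ω s)} ≤ ENNReal.ofReal (F (State.init P)) := by
  have h := coinMeasure_exists_one_le_le (M := fun l => ENNReal.ofReal (F (replay P adv l)))
    fun l => by
      rw [replay_append, replay_append, ← ENNReal.ofReal_add (h0 _) (h0 _),
        show (2 : ℝ≥0∞) = ENNReal.ofReal 2 by simp, ← ENNReal.ofReal_mul (by norm_num)]
      exact ENNReal.ofReal_le_ofReal (hF _ _)
  simp only [replay_coinPrefix, ENNReal.one_le_ofReal] at h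
  exact h

theorem IsPotential.sum {ι : Type*} (s : Finset ι) {F : ι → State P → ℝ}
    (h : ∀ i ∈ s, IsPotential (F i)) : IsPotential fun S => ∑ i ∈ s, F i S := by
  intro S mv
  rw [← Finset.sum_add_distrib, Finset.mul_sum]
  exact Finset.sum_le_sum fun i hi => h i hi S mv

theorem IsPotential.add {F F' : State P → ℝ} (h : IsPotential F) (h' : IsPotential F') :
    IsPotential fun S => F S + F' S := by
  intro S mv
  have := h S mv
  have := h' S mv
  dsimp only
  linarith

theorem IsPotential.mul_const {F : State P → ℝ} (h : IsPotential F) {x : ℝ} (hx : 0 ≤ x) :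
    IsPotential fun S => F S * x := by
  intro S mv
  have := mul_le_mul_of_nonneg_right (h S mv) hx
  dsimp only
  linarith

/-- One blackboard, after process `i` wrote `b`. -/
def appendRow {n : ℕ} (R : Fin n → List Bool) (i : Fin n) (b : Bool) : Fin n → List Bool :=
  fun j => if j = i then R j ++ [b] else R j

theorem append_board_self (S : State P) (i : Fin P.n) (b : Bool) :
    (S.append i b).board S.t = appendRow (S.board S.t) i b := by
  ext1 j
  simp [State.append, appendRow]

theorem append_board_of_ne (S : State P) (i : Fin P.n) (b : Bool) {τ : ℕ} (h : τ ≠ S.t) :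
    (S.append i b).board τ = S.board τ := by
  ext1 j
  simp [State.append, h]

open Classical in
/-- The exponential of a sum over the blackboards in `I`, stopped at `0` when a process in `J` gets
corrupted or a blackboard leaves `A`. -/
def expPotential (I : Finset ℕ) (J : Finset (Fin P.n)) (A : Set (Fin P.n → List Bool))
    (g : (Fin P.n → List Bool) → ℝ) (S : State P) : ℝ :=
  if Disjoint J S.bad ∧ ∀ τ ∈ I, S.board τ ∈ A then Real.exp (∑ τ ∈ I, g (S.board τ)) else 0

theorem expPotential_nonneg (I : Finset ℕ) (J : Finset (Fin P.n)) (A : Set (Fin P.n → List Bool))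
    (g : (Fin P.n → List Bool) → ℝ) (S : State P) : 0 ≤ expPotential I J A g S := by
  unfold expPotential
  split_ifs <;> positivity

theorem expPotential_of_board_eq {I : Finset ℕ} {J : Finset (Fin P.n)}
    {A : Set (Fin P.n → List Bool)} {g : (Fin P.n → List Bool) → ℝ} {S S' : State P}
    (hb : S'.board = S.board) (hbad : S.bad ⊆ S'.bad) :
    expPotential I J A g S' ≤ expPotential I J A g S := by
  classical
  by_cases h : Disjoint J S.bad
  · by_cases h' : Disjoint J S'.bad
    · rw [expPotential, expPotential, hb]
      exact (if_congr (and_congr_left' (iff_of_true h' h)) rfl rfl).le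
    · rw [expPotential, if_neg fun h'' => h' h''.1]
      exact expPotential_nonneg ..
  · rw [expPotential, if_neg fun h'' => h (h''.1.mono_right hbad)]
    exact expPotential_nonneg ..

/-- From `cosh a ≤ exp (a² / 2)`: the drift `-a² / 2` pays for a symmetric step `±a` in the
exponent. -/
theorem exp_add_exp_le (x a : ℝ) :
    Real.exp (x + (a - a ^ 2 / 2)) + Real.exp (x + (-a - a ^ 2 / 2)) ≤ 2 * Real.exp x := by
  have h1 := Real.cosh_le_exp_half_sq a
  rw [Real.cosh_eq] at h1
  have h2 : Real.exp (x + (a - a ^ 2 / 2)) + Real.exp (x + (-a - a ^ 2 / 2)) =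
      2 * (Real.exp x * Real.exp (-(a ^ 2 / 2))) * ((Real.exp a + Real.exp (-a)) / 2) := by
    have e1 : x + (a - a ^ 2 / 2) = x + -(a ^ 2 / 2) + a := by ring
    have e2 : x + (-a - a ^ 2 / 2) = x + -(a ^ 2 / 2) + -a := by ring
    rw [e1, e2, Real.exp_add _ a, Real.exp_add _ (-a), Real.exp_add]
    ring
  rw [h2]
  calc _ ≤ 2 * (Real.exp x * Real.exp (-(a ^ 2 / 2))) * Real.exp (a ^ 2 / 2) := by gcongr
    _ = 2 * Real.exp x := by
      rw [mul_assoc, mul_assoc, ← Real.exp_add]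
      simp

/-- Only a coin written by a process of `J` on a blackboard of `I` changes a live exponent, and
there the drift pays for the step. A value chosen by the adversary in a column of `J` needs a
corrupted writer, and then the potential is already `0`. That `A` is inherited by earlier
blackboards prevents a revival. -/
theorem isPotential_expPotential {I : Finset ℕ} {J : Finset (Fin P.n)}
    {A : Set (Fin P.n → List Bool)} {g : (Fin P.n → List Bool) → ℝ}
    (hJ : ∀ R i b, i ∉ J → g (appendRow R i b) = g R)
    (hA : ∀ R i b, appendRow R i b ∈ A → R ∈ A)
    (hg : ∀ R i, i ∈ J → R ∈ A → ∃ a, g (appendRow R i true) ≤ g R + (a - a ^ 2 / 2) ∧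
      g (appendRow R i false) ≤ g R + (-a - a ^ 2 / 2)) :
    IsPotential (expPotential I J A g) := by
  classical
  intro S mv
  have hsame : ∀ S' S'' : State P, expPotential I J A g S' ≤ expPotential I J A g S →
      expPotential I J A g S'' ≤ expPotential I J A g S →
      expPotential I J A g S' + expPotential I J A g S'' ≤ 2 * expPotential I J A g S :=
    fun S' S'' h h' => by linarith
  have halive : ∀ i b, (∀ τ ∈ I, (S.append i b).board τ ∈ A) → ∀ τ ∈ I, S.board τ ∈ A := by
    intro i b h τ hτ
    by_cases ht : τ = S.t
    · have := h τ hτ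
      rw [ht, append_board_self] at this
      rw [ht]
      exact hA _ _ _ this
    · rw [← append_board_of_ne S i b ht]
      exact h τ hτ
  have hrest : ∀ i b, ∑ τ ∈ I.erase S.t, g ((S.append i b).board τ) =
      ∑ τ ∈ I.erase S.t, g (S.board τ) := fun i b =>
    Finset.sum_congr rfl fun τ hτ => by rw [append_board_of_ne S i b (Finset.ne_of_mem_erase hτ)]
  have hle : ∀ i b x, (S.t ∈ I → g (appendRow (S.board S.t) i b) ≤ g (S.board S.t) + x) →
      (S.t ∉ I → 0 ≤ x) →
      Disjoint J S.bad → (∀ τ ∈ I, S.board τ ∈ A) →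
      expPotential I J A g (S.append i b) ≤ Real.exp (∑ τ ∈ I, g (S.board τ) + x) := by
    intro i b x hx hx' hd ha
    rw [expPotential]
    split_ifs
    · rw [Real.exp_le_exp]
      by_cases ht : S.t ∈ I
      · rw [← Finset.add_sum_erase _ _ ht, ← Finset.add_sum_erase (a := S.t) _ _ ht, hrest,
          append_board_self]
        linarith [hx ht]
      · have := hrest i b
        rw [Finset.erase_eq_of_notMem ht] at this
        linarith [hx' ht]
    · positivity
  have hdead : ∀ i b, ¬ (Disjoint J S.bad ∧ ∀ τ ∈ I, S.board τ ∈ A) →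
      expPotential I J A g (S.append i b) = 0 := fun i b h =>
    if_neg fun h' => h ⟨h'.1, halive i b h'.2⟩
  have hval : Disjoint J S.bad → (∀ τ ∈ I, S.board τ ∈ A) →
      expPotential I J A g S = Real.exp (∑ τ ∈ I, g (S.board τ)) := fun h h' => if_pos ⟨h, h'⟩
  have hout : ∀ i b, (i ∉ J ∨ S.t ∉ I) →
      expPotential I J A g (S.append i b) ≤ expPotential I J A g S := by
    intro i b h
    by_cases hal : Disjoint J S.bad ∧ ∀ τ ∈ I, S.board τ ∈ A
    · have := hle i b 0 (fun ht => by
        rw [hJ _ _ _ (h.resolve_right (not_not.2 ht)), add_zero]) (fun _ => le_rfl) hal.1 hal.2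
      rwa [add_zero, ← hval hal.1 hal.2] at this
    · rw [hdead i b hal]
      exact expPotential_nonneg ..
  cases mv with
  | idle => exact hsame _ _ le_rfl le_rfl
  | flip i =>
    simp only [State.step]
    split_ifs with h
    · by_cases hi : i ∉ J ∨ S.t ∉ I
      · exact hsame _ _ (hout i _ hi) (hout i _ hi)
      · push Not at hi
        by_cases hal : Disjoint J S.bad ∧ ∀ τ ∈ I, S.board τ ∈ A
        · obtain ⟨a, ha, ha'⟩ := hg _ i hi.1 (hal.2 _ hi.2)
          have h1 := hle i true _ (fun _ => ha) (fun h => absurd hi.2 h) hal.1 hal.2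
          have h2 := hle i false _ (fun _ => ha') (fun h => absurd hi.2 h) hal.1 hal.2
          rw [hval hal.1 hal.2]
          exact (add_le_add h1 h2).trans (exp_add_exp_le _ _)
        · rw [hdead i _ hal, hdead i _ hal, add_zero]
          exact mul_nonneg two_pos.le (expPotential_nonneg ..)
    · exact hsame _ _ le_rfl le_rfl
  | write i b =>
    simp only [State.step]
    split_ifs with h
    · by_cases hi : i ∈ J
      · have hal : ¬ (Disjoint J S.bad ∧ ∀ τ ∈ I, S.board τ ∈ A) := fun hal =>
          Finset.disjoint_left.1 hal.1 hi h.1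
        rw [hdead i _ hal, add_zero]
        exact mul_nonneg two_pos.le (expPotential_nonneg ..)
      · exact hsame _ _ (hout i _ (Or.inl hi)) (hout i _ (Or.inl hi))
    · exact hsame _ _ le_rfl le_rfl
  | corrupt i =>
    simp only [State.step]
    split_ifs with h
    · exact hsame _ _ (expPotential_of_board_eq rfl (Finset.subset_insert _ _))
        (expPotential_of_board_eq rfl (Finset.subset_insert _ _))
    · exact hsame _ _ le_rfl le_rfl
  | complete hidden =>
    simp only [State.step]
    split_ifs with h
    · exact hsame _ _ (expPotential_of_board_eq rfl subset_rfl)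
        (expPotential_of_board_eq rfl subset_rfl)
    · exact hsame _ _ le_rfl le_rfl

end Play

/-! ### Concentration of column sums and correlations -/

section Concentration

variable {P : Params}

/-- The sum of the `±1` values of a column. -/
def colSum (l : List Bool) : ℝ := (l.map fun b => if b then (1 : ℝ) else -1).sum

theorem colSum_append_true (l : List Bool) : colSum (l ++ [true]) = colSum l + 1 := by
  simp [colSum]

theorem colSum_append_false (l : List Bool) : colSum (l ++ [false]) = colSum l - 1 := by
  simp [colSum, sub_eq_add_neg]

theorem appendRow_self {n : ℕ} (R : Fin n → List Bool) (i : Fin n) (b : Bool) :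
    appendRow R i b i = R i ++ [b] := by
  simp [appendRow]

theorem appendRow_of_ne {n : ℕ} (R : Fin n → List Bool) {i j : Fin n} (h : j ≠ i) (b : Bool) :
    appendRow R i b j = R j := by
  simp [appendRow, h]

theorem Params.Xmax_nonneg : 0 ≤ P.Xmax := Real.sqrt_nonneg _

theorem Params.betaT_nonneg : 0 ≤ P.betaT := mul_nonneg (Nat.cast_nonneg _) (Real.sqrt_nonneg _)

/-- Controls the sum of column `i` of blackboard `τ`, on the side `σ = ±1`. -/
def columnPotential (σ : ℝ) (i : Fin P.n) (τ : ℕ) : State P → ℝ :=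
  expPotential {τ} {i} Set.univ fun R =>
    P.Xmax / P.m * σ * colSum (R i) - (P.Xmax / P.m) ^ 2 / 2 * (R i).length

theorem isPotential_columnPotential {σ : ℝ} (hσ : σ ^ 2 = 1) (i : Fin P.n) (τ : ℕ) :
    IsPotential (columnPotential σ i τ) := by
  refine isPotential_expPotential (fun R j b hj => ?_) (fun _ _ _ _ => Set.mem_univ _)
    (fun R j hj _ => ⟨P.Xmax / P.m * σ, ?_⟩)
  · rw [Finset.mem_singleton] at hj
    rw [appendRow_of_ne R (Ne.symm hj)]
  · rw [Finset.mem_singleton] at hj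
    subst hj
    rw [appendRow_self, appendRow_self, colSum_append_true, colSum_append_false, mul_pow, hσ]
    simp only [List.length_append, List.length_singleton, Nat.cast_add, Nat.cast_one]
    constructor <;> nlinarith

/-- The scale at which the sum of the products of two columns is controlled. -/
def pairScale (P : Params) : ℝ :=
  P.betaT / (4 * (P.c * Real.log P.n) * P.m ^ 2 * P.T)

/-- The blackboards in which the partial sums of the columns `i` and `j` are at most `X_max`. -/
def tameRows (P : Params) (i j : Fin P.n) : Set (Fin P.n → List Bool) :=
  {R | ∀ l, l <+: R i ∨ l <+: R j → |colSum l| ≤ P.Xmax}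

/-- Controls the sum, over the blackboards in `I`, of the products of the sums of the columns `i`
and `j`. -/
def pairPotential (I : Finset ℕ) (i j : Fin P.n) : State P → ℝ :=
  expPotential I {i, j} (tameRows P i j) fun R =>
    pairScale P * (colSum (R i) * colSum (R j) - if i = j then ((R i).length : ℝ) else 0) -
      pairScale P ^ 2 * P.Xmax ^ 2 * ((R i).length + (R j).length)

/-- A coin of `i` changes `X_i X_j` by `±X_j`, and a coin in the diagonal case changes `X_i² -
length` by `±2 X_i`. The compensator is exactly what the diagonal case needs, where the length
counts twice; off the diagonal it is generous. -/
theorem isPotential_pairPotential (I : Finset ℕ) (i j : Fin P.n) :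
    IsPotential (pairPotential I i j) := by
  refine isPotential_expPotential (fun R k b hk => ?_) (fun R k b h l hl => ?_)
    (fun R k hk hR => ?_)
  · simp only [Finset.mem_insert, Finset.mem_singleton, not_or] at hk
    rw [appendRow_of_ne R (Ne.symm hk.1), appendRow_of_ne R (Ne.symm hk.2)]
  · refine h l (hl.imp (fun h' => h'.trans ?_) (fun h' => h'.trans ?_)) <;>
      (unfold appendRow; split_ifs <;> simp)
  · have hi := sq_le_sq' (neg_le_of_abs_le (hR (R i) (Or.inl List.prefix_rfl)))
      (le_of_abs_le (hR (R i) (Or.inl List.prefix_rfl)))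
    have hj := sq_le_sq' (neg_le_of_abs_le (hR (R j) (Or.inr List.prefix_rfl)))
      (le_of_abs_le (hR (R j) (Or.inr List.prefix_rfl)))
    have hi' := mul_le_mul_of_nonneg_left hi (sq_nonneg (pairScale P))
    have hj' := mul_le_mul_of_nonneg_left hj (sq_nonneg (pairScale P))
    have hM : 0 ≤ pairScale P ^ 2 * P.Xmax ^ 2 := by positivity
    simp only [Finset.mem_insert, Finset.mem_singleton] at hk
    by_cases hij : i = j
    · subst hij
      obtain rfl : k = i := by tauto
      refine ⟨2 * pairScale P * colSum (R k), ?_⟩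
      simp only [appendRow_self, colSum_append_true, colSum_append_false, if_true,
        List.length_append, List.length_singleton, Nat.cast_add, Nat.cast_one]
      constructor <;> nlinarith
    · rcases hk with rfl | rfl
      · refine ⟨pairScale P * colSum (R j), ?_⟩
        simp only [appendRow_self, appendRow_of_ne R (Ne.symm hij), colSum_append_true,
          colSum_append_false, if_neg hij, List.length_append, List.length_singleton,
          Nat.cast_add, Nat.cast_one]
        constructor <;> nlinarith
      · refine ⟨pairScale P * colSum (R i), ?_⟩
        simp only [appendRow_self, appendRow_of_ne R hij, colSum_append_true,
          colSum_append_false, if_neg hij, List.length_append, List.length_singleton,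
          Nat.cast_add, Nat.cast_one]
        constructor <;> nlinarith

/-- The iterations of epoch `κ + 1`. -/
def epochIter (P : Params) (κ : ℕ) : Finset ℕ := Finset.Ico (κ * P.T) ((κ + 1) * P.T)

/-- Controls all columns and all pairs of columns in the first `N` epochs. -/
def totalPotential (N : ℕ) (S : State P) : ℝ :=
  ∑ τ ∈ Finset.range (N * P.T), ∑ i, (columnPotential 1 i τ S + columnPotential (-1) i τ S) *
      Real.exp (-(P.c * Real.log P.n / 2)) +
    ∑ κ ∈ Finset.range N, ∑ i, ∑ j, pairPotential (epochIter P κ) i j S *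
      Real.exp (-((P.c * Real.log P.n) ^ 2 / 8))

theorem isPotential_totalPotential (N : ℕ) : IsPotential (totalPotential (P := P) N) :=
  IsPotential.add
    (IsPotential.sum _ fun τ _ => IsPotential.sum _ fun i _ =>
      ((isPotential_columnPotential (by norm_num) i τ).add
        (isPotential_columnPotential (by norm_num) i τ)).mul_const (Real.exp_nonneg _))
    (IsPotential.sum _ fun κ _ => IsPotential.sum _ fun i _ => IsPotential.sum _ fun j _ =>
      (isPotential_pairPotential _ i j).mul_const (Real.exp_nonneg _))

theorem columnPotential_nonneg (σ : ℝ) (i : Fin P.n) (τ : ℕ) (S : State P) :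
    0 ≤ columnPotential σ i τ S := expPotential_nonneg ..

theorem pairPotential_nonneg (I : Finset ℕ) (i j : Fin P.n) (S : State P) :
    0 ≤ pairPotential I i j S := expPotential_nonneg ..

theorem totalPotential_nonneg (N : ℕ) (S : State P) : 0 ≤ totalPotential N S := by
  refine add_nonneg (Finset.sum_nonneg fun τ _ => Finset.sum_nonneg fun i _ => ?_)
    (Finset.sum_nonneg fun κ _ => Finset.sum_nonneg fun i _ => Finset.sum_nonneg fun j _ => ?_)
  · exact mul_nonneg (add_nonneg (columnPotential_nonneg ..) (columnPotential_nonneg ..))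
      (Real.exp_nonneg _)
  · exact mul_nonneg (pairPotential_nonneg ..) (Real.exp_nonneg _)

theorem totalPotential_init_le (N : ℕ) :
    totalPotential N (State.init P) ≤
      2 * N * P.T * P.n * Real.exp (-(P.c * Real.log P.n / 2)) +
      N * P.n ^ 2 * Real.exp (-((P.c * Real.log P.n) ^ 2 / 8)) := by
  have hexp : ∀ I J A (g : (Fin P.n → List Bool) → ℝ), g (fun _ => []) = 0 →
      expPotential I J A g (State.init P) ≤ 1 := by
    intro I J A g h
    unfold expPotential State.init
    split_ifs <;> simp [h]
  have hcol : ∀ σ i τ, columnPotential σ i τ (State.init P) ≤ 1 := fun σ i τ =>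
    hexp _ _ _ _ (by simp [colSum])
  have hpair : ∀ I i j, pairPotential I i j (State.init P) ≤ 1 := fun I i j =>
    hexp _ _ _ _ (by simp [colSum])
  have h1 : ∑ τ ∈ Finset.range (N * P.T), ∑ i : Fin P.n,
      (columnPotential 1 i τ (State.init P) + columnPotential (-1) i τ (State.init P)) *
        Real.exp (-(P.c * Real.log P.n / 2)) ≤
      ∑ τ ∈ Finset.range (N * P.T), ∑ i : Fin P.n, 2 * Real.exp (-(P.c * Real.log P.n / 2)) := by
    refine Finset.sum_le_sum fun τ _ => Finset.sum_le_sum fun i _ => ?_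
    gcongr
    linarith [hcol 1 i τ, hcol (-1) i τ]
  have h2 : ∑ κ ∈ Finset.range N, ∑ i, ∑ j, pairPotential (epochIter P κ) i j (State.init P) *
        Real.exp (-((P.c * Real.log P.n) ^ 2 / 8)) ≤
      ∑ κ ∈ Finset.range N, ∑ i : Fin P.n, ∑ j : Fin P.n,
        1 * Real.exp (-((P.c * Real.log P.n) ^ 2 / 8)) := by
    refine Finset.sum_le_sum fun κ _ => Finset.sum_le_sum fun i _ => Finset.sum_le_sum fun j _ => ?_
    gcongr
    exact hpair _ _ _
  refine (add_le_add h1 h2).trans (le_of_eq ?_)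
  simp only [Finset.sum_const, Finset.card_range, Finset.card_univ, Fintype.card_fin, nsmul_eq_mul]
  push_cast
  ring

theorem columnPotential_mul_lt_one {N : ℕ} {S : State P} (h : totalPotential N S < 1) {τ : ℕ}
    (hτ : τ < N * P.T) (i : Fin P.n) :
    columnPotential 1 i τ S * Real.exp (-(P.c * Real.log P.n / 2)) < 1 ∧
      columnPotential (-1) i τ S * Real.exp (-(P.c * Real.log P.n / 2)) < 1 := by
  have hnn : ∀ τ i, 0 ≤ (columnPotential 1 i τ S + columnPotential (-1) i τ S) *
      Real.exp (-(P.c * Real.log P.n / 2)) := fun τ i =>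
    mul_nonneg (add_nonneg (columnPotential_nonneg ..) (columnPotential_nonneg ..))
      (Real.exp_nonneg _)
  have h1 := Finset.single_le_sum (f := fun i => (columnPotential 1 i τ S +
    columnPotential (-1) i τ S) * Real.exp (-(P.c * Real.log P.n / 2)))
    (fun i _ => hnn τ i) (Finset.mem_univ i)
  have h2 := Finset.single_le_sum (f := fun τ => ∑ i, (columnPotential 1 i τ S +
    columnPotential (-1) i τ S) * Real.exp (-(P.c * Real.log P.n / 2)))
    (fun τ _ => Finset.sum_nonneg fun i _ => hnn τ i) (Finset.mem_range.2 hτ)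
  have h3 : 0 ≤ ∑ κ ∈ Finset.range N, ∑ i, ∑ j, pairPotential (epochIter P κ) i j S *
      Real.exp (-((P.c * Real.log P.n) ^ 2 / 8)) :=
    Finset.sum_nonneg fun κ _ => Finset.sum_nonneg fun i _ => Finset.sum_nonneg fun j _ =>
      mul_nonneg (pairPotential_nonneg ..) (Real.exp_nonneg _)
  have h4 := mul_nonneg (columnPotential_nonneg 1 i τ S)
    (Real.exp_nonneg (-(P.c * Real.log P.n / 2)))
  have h5 := mul_nonneg (columnPotential_nonneg (-1) i τ S)
    (Real.exp_nonneg (-(P.c * Real.log P.n / 2)))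
  rw [totalPotential] at h
  constructor <;> linarith

theorem pairPotential_mul_lt_one {N : ℕ} {S : State P} (h : totalPotential N S < 1) {κ : ℕ}
    (hκ : κ < N) (i j : Fin P.n) :
    pairPotential (epochIter P κ) i j S * Real.exp (-((P.c * Real.log P.n) ^ 2 / 8)) < 1 := by
  have hnn : ∀ κ i j, 0 ≤ pairPotential (epochIter P κ) i j S *
      Real.exp (-((P.c * Real.log P.n) ^ 2 / 8)) := fun κ i j =>
    mul_nonneg (pairPotential_nonneg ..) (Real.exp_nonneg _)
  have h1 := Finset.single_le_sum (fun j _ => hnn κ i j) (Finset.mem_univ j)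
  have h2 := Finset.single_le_sum
    (fun i _ => Finset.sum_nonneg fun j (_ : j ∈ Finset.univ) => hnn κ i j) (Finset.mem_univ i)
  have h3 := Finset.single_le_sum (fun κ _ => Finset.sum_nonneg fun i (_ : i ∈ Finset.univ) =>
    Finset.sum_nonneg fun j (_ : j ∈ Finset.univ) => hnn κ i j) (Finset.mem_range.2 hκ)
  have h4 : 0 ≤ ∑ τ ∈ Finset.range (N * P.T), ∑ i, (columnPotential 1 i τ S +
      columnPotential (-1) i τ S) * Real.exp (-(P.c * Real.log P.n / 2)) :=
    Finset.sum_nonneg fun τ _ => Finset.sum_nonneg fun i _ =>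
      mul_nonneg (add_nonneg (columnPotential_nonneg ..) (columnPotential_nonneg ..))
        (Real.exp_nonneg _)
  rw [totalPotential] at h
  linarith

theorem Params.Xmax_sq (hL : 0 ≤ P.c * Real.log P.n) :
    P.Xmax ^ 2 = P.c * Real.log P.n * P.m := by
  rw [Params.Xmax, Real.sq_sqrt]
  · ring
  · nlinarith [(Nat.cast_nonneg P.m : (0 : ℝ) ≤ P.m)]

theorem Params.betaT_sq (hL : 0 ≤ P.c * Real.log P.n) :
    P.betaT ^ 2 = P.m ^ 2 * (P.T * (P.c * Real.log P.n) ^ 3) := by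
  rw [Params.betaT, mul_pow, Real.sq_sqrt (by positivity)]

theorem abs_colSum_le_Xmax {N : ℕ} {S : State P} (hm : 0 < P.m) (hL : 0 < P.c * Real.log P.n)
    (h : totalPotential N S < 1) {τ : ℕ} (hτ : τ < N * P.T) {i : Fin P.n} (hi : i ∉ S.bad)
    (hlen : (S.board τ i).length ≤ P.m) : |colSum (S.board τ i)| ≤ P.Xmax := by
  have hm' : (0 : ℝ) < P.m := by exact_mod_cast hm
  have hlen' : ((S.board τ i).length : ℝ) ≤ P.m := by exact_mod_cast hlen
  have hX := P.Xmax_sq hL.le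
  have hside : ∀ σ : ℝ, columnPotential σ i τ S * Real.exp (-(P.c * Real.log P.n / 2)) < 1 →
      σ * colSum (S.board τ i) ≤ P.Xmax := by
    intro σ hσ
    by_contra! hcon
    refine hσ.not_ge ?_
    rw [columnPotential, expPotential, if_pos (by simpa using hi), ← Real.exp_add,
      Finset.sum_singleton, Real.one_le_exp_iff]
    have h1 : P.Xmax / P.m * P.Xmax ≤ P.Xmax / P.m * (σ * colSum (S.board τ i)) :=
      mul_le_mul_of_nonneg_left hcon.le (div_nonneg P.Xmax_nonneg hm'.le)
    have h2 : (P.Xmax / P.m) ^ 2 / 2 * (S.board τ i).length ≤ (P.Xmax / P.m) ^ 2 / 2 * P.m :=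
      mul_le_mul_of_nonneg_left hlen' (by positivity)
    -- The tilt `X_max / m` is optimal: the gain `c ln n` minus the compensator `c ln n / 2` leaves
    -- the exponent that the weight in `totalPotential` cancels.
    have h3 : P.Xmax / P.m * P.Xmax = P.c * Real.log P.n := by
      rw [div_mul_eq_mul_div, ← sq, hX, mul_div_assoc, div_self hm'.ne', mul_one]
    have h4 : (P.Xmax / P.m) ^ 2 / 2 * P.m = P.c * Real.log P.n / 2 := by
      rw [← h3]; field_simp
    linarith
  obtain ⟨h1, h2⟩ := columnPotential_mul_lt_one h hτ i
  have h1 := hside 1 h1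
  have h2 := hside (-1) h2
  exact abs_le.2 ⟨by linarith, by linarith⟩

theorem sum_colSum_mul_le {N : ℕ} {S : State P} (hm : 0 < P.m) (hT : 0 < P.T)
    (hL : 0 < P.c * Real.log P.n) (h : totalPotential N S < 1) {κ : ℕ} (hκ : κ < N)
    {i j : Fin P.n} (hi : i ∉ S.bad) (hj : j ∉ S.bad)
    (htame : ∀ τ ∈ epochIter P κ, S.board τ ∈ tameRows P i j)
    (hlen : ∀ τ i, (S.board τ i).length ≤ P.m) :
    ∑ τ ∈ epochIter P κ, colSum (S.board τ i) * colSum (S.board τ j) ≤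
      P.betaT + if i = j then (P.m * P.T : ℝ) else 0 := by
  have hm' : (0 : ℝ) < P.m := by exact_mod_cast hm
  have hT' : (0 : ℝ) < P.T := by exact_mod_cast hT
  have hX := P.Xmax_sq hL.le
  have hB := P.betaT_sq hL.le
  have hlensum : ∀ k, ∑ τ ∈ epochIter P κ, ((S.board τ k).length : ℝ) ≤ P.m * P.T := by
    intro k
    calc ∑ τ ∈ epochIter P κ, ((S.board τ k).length : ℝ) ≤ ∑ τ ∈ epochIter P κ, (P.m : ℝ) :=
          Finset.sum_le_sum fun τ _ => by exact_mod_cast hlen τ k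
      _ = P.m * P.T := by
        rw [Finset.sum_const, epochIter, Nat.card_Ico, nsmul_eq_mul, ← Nat.sub_mul,
          Nat.add_sub_cancel_left, one_mul, mul_comm]
  by_contra! hcon
  refine (pairPotential_mul_lt_one h hκ i j).not_ge ?_
  rw [pairPotential, expPotential, if_pos ⟨by simp [hi, hj], htame⟩, ← Real.exp_add,
    Real.one_le_exp_iff, Finset.sum_sub_distrib, ← Finset.mul_sum, ← Finset.mul_sum,
    Finset.sum_sub_distrib, Finset.sum_add_distrib]
  have hscale : 0 ≤ pairScale P := by
    unfold pairScale
    exact div_nonneg P.betaT_nonneg (by positivity)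
  have h1 : P.betaT ≤ ∑ τ ∈ epochIter P κ, colSum (S.board τ i) * colSum (S.board τ j) -
      ∑ τ ∈ epochIter P κ, if i = j then ((S.board τ i).length : ℝ) else 0 := by
    by_cases hij : i = j
    · simp only [hij, if_true] at hcon ⊢
      linarith [hlensum j]
    · simp only [hij, if_false, Finset.sum_const_zero] at hcon ⊢
      linarith
  have h2 := mul_le_mul_of_nonneg_left h1 hscale
  have h3 := mul_le_mul_of_nonneg_left (add_le_add (hlensum i) (hlensum j))
    (mul_nonneg (sq_nonneg (pairScale P)) (sq_nonneg P.Xmax))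
  -- With `L = c ln n`, `pairScale` maximises `s β_T - 2 s² X_max² m T`: the gain is `L² / 4`, the
  -- compensator `L² / 8`.
  have h4 : pairScale P * P.betaT = (P.c * Real.log P.n) ^ 2 / 4 := by
    rw [pairScale, div_mul_eq_mul_div, ← sq, hB]
    field_simp
  have h5 : pairScale P ^ 2 * P.Xmax ^ 2 * (P.m * P.T + P.m * P.T) =
      (P.c * Real.log P.n) ^ 2 / 8 := by
    rw [pairScale, div_pow, hX, hB]
    field_simp
    ring
  linarith

end Concentration

/-! ### Views against the true blackboards -/

section Views

variable {P : Params}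

theorem columnValue_eq (l : List Bool) :
    columnValue P l = max (-P.Xmax) (min P.Xmax (colSum l)) := rfl

theorem columnValue_of_abs_le {l : List Bool} (h : |colSum l| ≤ P.Xmax) :
    columnValue P l = colSum l := by
  rw [abs_le] at h
  rw [columnValue_eq, min_eq_right h.2, max_eq_right h.1]

theorem abs_columnValue_le (l : List Bool) : |columnValue P l| ≤ P.Xmax := by
  rw [columnValue_eq, abs_le]
  have := P.Xmax_nonneg
  exact ⟨le_max_left _ _, max_le (by linarith) (min_le_left _ _)⟩

theorem abs_columnValue_sub_le (l l' : List Bool) :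
    |columnValue P l - columnValue P l'| ≤ |colSum l - colSum l'| := by
  rw [columnValue_eq, columnValue_eq]
  rw [max_comm, max_comm (-P.Xmax), min_comm, min_comm P.Xmax]
  refine (abs_max_sub_max_le_abs _ _ _).trans ?_
  simpa using abs_min_sub_min_le_max (colSum l) P.Xmax (colSum l') P.Xmax

theorem abs_colSum_dropLast_sub_le (l : List Bool) : |colSum l.dropLast - colSum l| ≤ 1 := by
  rcases List.eq_nil_or_concat l with rfl | ⟨l, b, rfl⟩
  · simp [colSum]
  · rw [List.concat_eq_append, List.dropLast_concat]
    cases b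
    · rw [colSum_append_false]; simp
    · rw [colSum_append_true]; simp

/-- At most one cell per hidden process is blanked in the whole history, on the last blackboard
where it wrote. This changes that column sum by at most `1`, and clipping is a contraction. -/
theorem sum_abs_view_sub_le (S : State P) (hidden : Finset (Fin P.n)) (I : Finset ℕ)
    (i : Fin P.n) :
    ∑ τ ∈ I, |columnValue P (S.viewColumn hidden τ i) - columnValue P (S.board τ i)| ≤
      if i ∈ hidden then 1 else 0 := by
  have hle : ∀ τ, |columnValue P (S.viewColumn hidden τ i) - columnValue P (S.board τ i)| ≤ 1 := by
    intro τ
    refine (abs_columnValue_sub_le _ _).trans ?_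
    unfold State.viewColumn
    split_ifs
    · exact abs_colSum_dropLast_sub_le _
    · simp
  split_ifs with hi
  · by_cases hex : ∃ σ, S.board σ i ≠ [] ∧ ∀ τ > σ, S.board τ i = []
    · obtain ⟨σ, hσ, hσ'⟩ := hex
      have hzero : ∀ τ, τ ≠ σ →
          |columnValue P (S.viewColumn hidden τ i) - columnValue P (S.board τ i)| = 0 := by
        intro τ hτ
        rw [abs_eq_zero, sub_eq_zero]
        congr 1
        rcases lt_or_gt_of_ne hτ with h | h
        · exact if_neg fun h' => hσ (h'.2 σ h)
        · unfold State.viewColumn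
          rw [hσ' τ h]
          simp
      by_cases hσI : σ ∈ I
      · rw [Finset.sum_eq_single_of_mem σ hσI fun τ _ h => hzero τ h]
        exact hle σ
      · rw [Finset.sum_eq_zero fun τ hτ => hzero τ (ne_of_mem_of_not_mem hτ hσI)]
        exact zero_le_one
    -- Without a last nonempty blackboard, the column is empty everywhere or nonempty arbitrarily
    -- late; either way the view changes nothing.
    · push Not at hex
      refine (Finset.sum_eq_zero fun τ _ => ?_).trans_le zero_le_one
      rw [abs_eq_zero, sub_eq_zero]
      congr 1
      unfold State.viewColumn
      split_ifs with h
      · by_cases hτ : S.board τ i = []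
        · rw [hτ]; rfl
        · obtain ⟨τ', h1, h2⟩ := hex τ hτ
          exact absurd (h.2 τ' h1) h2
      · rfl
  · refine (Finset.sum_eq_zero fun τ _ => ?_).le
    rw [abs_eq_zero, sub_eq_zero]
    exact congrArg _ (if_neg fun h => hi h.1)

end Views

/-! ### Excess graph and loss of weight in one epoch -/

section ExcessGraph

variable {P : Params}

theorem corr_comm {V : Type} (I : Finset ℕ) (w : V → ℝ) (X : ℕ → V → ℝ) (i j : V) :
    corr I w X i j = corr I w X j i :=
  Finset.sum_congr rfl fun _ _ => by ring

theorem dev_eq_corr {V : Type} (I : Finset ℕ) (w : V → ℝ) (X : ℕ → V → ℝ) (i : V) :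
    dev I w X i = corr I w X i i :=
  Finset.sum_congr rfl fun _ _ => by ring

theorem Params.alphaT_eq : P.alphaT = P.m * P.T + P.betaT := by
  rw [Params.alphaT, Params.betaT, mul_add]

theorem Params.alphaT_nonneg : 0 ≤ P.alphaT := by
  have := P.betaT_nonneg
  rw [Params.alphaT_eq]
  positivity

theorem excessCap_nonneg (hε : 0 ≤ P.ε) (I : Finset ℕ) (w : Fin P.n → ℝ) (X : ℕ → Fin P.n → ℝ)
    (i j : Fin P.n) : 0 ≤ excessCap P I w X i j := by
  have := P.alphaT_nonneg
  unfold excessCap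
  split_ifs <;> positivity

theorem excessCap_symm (I : Finset ℕ) (w : Fin P.n → ℝ) (X : ℕ → Fin P.n → ℝ)
    (i j : Fin P.n) : excessCap P I w X i j = excessCap P I w X j i := by
  by_cases h : i = j
  · rw [h]
  · rw [excessCap, excessCap, if_neg h, if_neg (Ne.symm h), corr_comm, mul_comm (w i)]

theorem abs_corr_sub_le {I : Finset ℕ} {w : Fin P.n → ℝ} (hw : ∀ i, 0 ≤ w i ∧ w i ≤ 1)
    {X Y : ℕ → Fin P.n → ℝ} (hX : ∀ τ i, |X τ i| ≤ P.Xmax) (hY : ∀ τ i, |Y τ i| ≤ P.Xmax)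
    {d : Fin P.n → ℝ} (hd : ∀ i, ∑ τ ∈ I, |X τ i - Y τ i| ≤ d i) (i j : Fin P.n) :
    |corr I w X i j - corr I w Y i j| ≤ P.Xmax * (d i + d j) := by
  have hterm : ∀ τ, |w i * w j * X τ i * X τ j - w i * w j * Y τ i * Y τ j| ≤
      P.Xmax * (|X τ i - Y τ i| + |X τ j - Y τ j|) := by
    intro τ
    have hww : |w i * w j| ≤ 1 := by
      rw [abs_of_nonneg (mul_nonneg (hw i).1 (hw j).1)]
      exact mul_le_one₀ (hw i).2 (hw j).1 (hw j).2
    calc |w i * w j * X τ i * X τ j - w i * w j * Y τ i * Y τ j|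
        = |w i * w j| * |(X τ i - Y τ i) * X τ j + Y τ i * (X τ j - Y τ j)| := by
          rw [← abs_mul]; ring_nf
      _ ≤ 1 * |(X τ i - Y τ i) * X τ j + Y τ i * (X τ j - Y τ j)| := by gcongr
      _ ≤ |X τ i - Y τ i| * |X τ j| + |Y τ i| * |X τ j - Y τ j| := by
        rw [one_mul, ← abs_mul, ← abs_mul]; exact abs_add_le _ _
      _ ≤ |X τ i - Y τ i| * P.Xmax + P.Xmax * |X τ j - Y τ j| := by
        gcongr
        · exact hX τ j
        · exact hY τ i
      _ = _ := by ring
  calc |corr I w X i j - corr I w Y i j|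
      ≤ ∑ τ ∈ I, |w i * w j * X τ i * X τ j - w i * w j * Y τ i * Y τ j| := by
        rw [corr, corr, ← Finset.sum_sub_distrib]
        exact Finset.abs_sum_le_sum_abs _ _
    _ ≤ ∑ τ ∈ I, P.Xmax * (|X τ i - Y τ i| + |X τ j - Y τ j|) :=
        Finset.sum_le_sum fun τ _ => hterm τ
    _ = P.Xmax * (∑ τ ∈ I, |X τ i - Y τ i| + ∑ τ ∈ I, |X τ j - Y τ j|) := by
        rw [← Finset.mul_sum, Finset.sum_add_distrib]
    _ ≤ _ := mul_le_mul_of_nonneg_left (add_le_add (hd i) (hd j)) P.Xmax_nonneg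

theorem abs_excessCap_sub_le (hε : 0 ≤ P.ε) {I : Finset ℕ} {w : Fin P.n → ℝ}
    (hw : ∀ i, 0 ≤ w i ∧ w i ≤ 1) {X Y : ℕ → Fin P.n → ℝ} (hX : ∀ τ i, |X τ i| ≤ P.Xmax)
    (hY : ∀ τ i, |Y τ i| ≤ P.Xmax) {d : Fin P.n → ℝ}
    (hd : ∀ i, ∑ τ ∈ I, |X τ i - Y τ i| ≤ d i) (i j : Fin P.n) :
    |excessCap P I w X i j - excessCap P I w Y i j| ≤
      16 / (P.ε * P.f * P.alphaT) * (2 * (P.Xmax * (d i + d j))) := by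
  have hα := P.alphaT_nonneg
  have hK : 0 ≤ 16 / (P.ε * P.f * P.alphaT) := by positivity
  have hmax : ∀ x y z : ℝ, |max 0 (x - z) - max 0 (y - z)| ≤ |x - y| := by
    intro x y z
    rw [max_comm, max_comm 0]
    exact (abs_max_sub_max_le_abs _ _ _).trans (by ring_nf; rfl)
  have hcorr := abs_corr_sub_le hw hX hY hd i j
  unfold excessCap
  split_ifs with h
  · subst h
    rw [← mul_sub, abs_mul, abs_of_nonneg hK, dev_eq_corr, dev_eq_corr]
    refine mul_le_mul_of_nonneg_left ((hmax _ _ _).trans ?_) hK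
    linarith [abs_nonneg (corr I w X i i - corr I w Y i i)]
  · rw [← mul_sub, ← mul_sub, abs_mul, abs_mul, abs_of_nonneg hK, abs_two]
    gcongr
    exact (hmax _ _ _).trans hcorr

/-- The excess graph has no edge between processes with small scores. -/
theorem excessCap_eq_zero {I : Finset ℕ} {w : Fin P.n → ℝ} (hw : ∀ i, 0 ≤ w i)
    {X : ℕ → Fin P.n → ℝ} {i j : Fin P.n}
    (h : ∑ τ ∈ I, X τ i * X τ j ≤ P.betaT + if i = j then (P.m * P.T : ℝ) else 0) :
    excessCap P I w X i j = 0 := by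
  have hcorr : corr I w X i j = w i * w j * ∑ τ ∈ I, X τ i * X τ j := by
    rw [corr, Finset.mul_sum]
    exact Finset.sum_congr rfl fun _ _ => by ring
  have hle := mul_le_mul_of_nonneg_left h (mul_nonneg (hw i) (hw j))
  rw [← hcorr] at hle
  unfold excessCap
  split_ifs with hij
  · subst hij
    rw [if_pos rfl] at hle
    rw [max_eq_left, mul_zero]
    rw [dev_eq_corr, Params.alphaT_eq]
    linarith
  · rw [if_neg hij, add_zero] at hle
    rw [max_eq_left, mul_zero, mul_zero]
    linarith

/-- The weight that process `i` loses according to the column values `X`. -/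
def load (P : Params) (I : Finset ℕ) (w : Fin P.n → ℝ) (X : ℕ → Fin P.n → ℝ) (i : Fin P.n) : ℝ :=
  ∑ j, risingTide w (excessCap P I w X) i j

theorem load_nonneg (hε : 0 ≤ P.ε) {w : Fin P.n → ℝ} (hw : ∀ i, 0 ≤ w i) (I : Finset ℕ)
    (X : ℕ → Fin P.n → ℝ) (i : Fin P.n) : 0 ≤ load P I w X i :=
  Finset.sum_nonneg fun j _ =>
    ((isFeasible_risingTide hw (excessCap_nonneg hε I w X) (excessCap_symm I w X)).1 i j).1

theorem load_le (hε : 0 ≤ P.ε) {w : Fin P.n → ℝ} (hw : ∀ i, 0 ≤ w i) (I : Finset ℕ)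
    (X : ℕ → Fin P.n → ℝ) (i : Fin P.n) : load P I w X i ≤ w i :=
  (isFeasible_risingTide hw (excessCap_nonneg hε I w X) (excessCap_symm I w X)).2 i

theorem Params.wmin_nonneg : 0 ≤ P.wmin := div_nonneg (Real.sqrt_nonneg _) (Nat.cast_nonneg _)

theorem consensusWeight_bounds (hε : 0 ≤ P.ε) {w : Fin P.n → ℝ} (hw : ∀ i, 0 ≤ w i)
    (I : Finset ℕ) (X : Fin P.n → ℕ → Fin P.n → ℝ) (i : Fin P.n) :
    0 ≤ consensusWeight P I w X i ∧
      load P I w (X i) i ≤ w i - consensusWeight P I w X i ∧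
      w i - consensusWeight P I w X i ≤ load P I w (X i) i + P.wmin := by
  have h1 := load_le hε hw I (X i) i
  have h2 : localWeight P I w (X i) i = w i - load P I w (X i) i := rfl
  have h3 := P.wmin_nonneg
  unfold consensusWeight
  split_ifs with h <;> rw [h2] at * <;> refine ⟨?_, ?_, ?_⟩ <;> linarith

/-- If `G` is independent in the excess graph, `G` loses at most as much as its complement. -/
theorem sum_load_le (hε : 0 ≤ P.ε) {w : Fin P.n → ℝ} (hw : ∀ i, 0 ≤ w i) {I : Finset ℕ}
    {X : ℕ → Fin P.n → ℝ} {G : Finset (Fin P.n)}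
    (hG : ∀ i ∈ G, ∀ j ∈ G, excessCap P I w X i j = 0) :
    ∑ i ∈ G, load P I w X i ≤ ∑ i ∈ Gᶜ, load P I w X i := by
  have hE := excessCap_nonneg hε I w X
  have hs := excessCap_symm I w X
  have hf := (isFeasible_risingTide hw hE hs).1
  calc ∑ i ∈ G, load P I w X i
      = ∑ i ∈ G, ∑ j ∈ Gᶜ, risingTide w (excessCap P I w X) i j := by
        refine Finset.sum_congr rfl fun i hi => ?_
        rw [load, ← Finset.sum_add_sum_compl G, Finset.sum_eq_zero, zero_add]
        intro j hj
        have := hf i j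
        rw [hG i hi j hj] at this
        exact le_antisymm this.2 this.1
    _ = ∑ j ∈ Gᶜ, ∑ i ∈ G, risingTide w (excessCap P I w X) j i := by
        rw [Finset.sum_comm]
        exact Finset.sum_congr rfl fun j _ => Finset.sum_congr rfl fun i _ =>
          risingTide_symm hw hE hs i j
    _ ≤ ∑ j ∈ Gᶜ, load P I w X j :=
        Finset.sum_le_sum fun j _ => Finset.sum_le_sum_of_subset_of_nonneg (Finset.subset_univ _)
          fun i _ _ => (hf j i).1

/-- One coordinate is bounded by the `ℓ¹` distance, so the Lipschitz bound applies; summing `d i + d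
j` over all pairs gives `2 n ∑ d`. -/
theorem abs_load_sub_le (hε : 0 ≤ P.ε) {I : Finset ℕ} {w : Fin P.n → ℝ}
    (hw : ∀ i, 0 ≤ w i ∧ w i ≤ 1) {X Y : ℕ → Fin P.n → ℝ} (hX : ∀ τ i, |X τ i| ≤ P.Xmax)
    (hY : ∀ τ i, |Y τ i| ≤ P.Xmax) {d : Fin P.n → ℝ}
    (hd : ∀ i, ∑ τ ∈ I, |X τ i - Y τ i| ≤ d i) (i : Fin P.n) :
    |load P I w X i - load P I w Y i| ≤
      16 / (P.ε * P.f * P.alphaT) * (2 * (P.Xmax * (2 * (P.n * ∑ i, d i)))) := by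
  have hw0 : ∀ i, 0 ≤ w i := fun i => (hw i).1
  calc |load P I w X i - load P I w Y i|
      ≤ ∑ i, |load P I w X i - load P I w Y i| :=
        Finset.single_le_sum (f := fun i => |load P I w X i - load P I w Y i|)
          (fun _ _ => abs_nonneg _) (Finset.mem_univ i)
    _ ≤ ∑ i, ∑ j, |excessCap P I w X i j - excessCap P I w Y i j| :=
        sum_abs_load_sub_le hw0 (excessCap_nonneg hε I w X) (excessCap_symm I w X)
          (excessCap_nonneg hε I w Y) (excessCap_symm I w Y)
    _ ≤ ∑ i, ∑ j, 16 / (P.ε * P.f * P.alphaT) * (2 * (P.Xmax * (d i + d j))) :=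
        Finset.sum_le_sum fun i _ => Finset.sum_le_sum fun j _ =>
          abs_excessCap_sub_le hε hw hX hY hd i j
    _ = _ := by
        simp only [← Finset.mul_sum, Finset.sum_add_distrib, Finset.sum_const, Finset.card_univ,
          Fintype.card_fin, nsmul_eq_mul]
        ring

/-- The loss of the good processes in one epoch that is not matched by a loss of the bad ones. -/
def epochSlack (P : Params) : ℝ :=
  P.n * (16 / (P.ε * P.f * P.alphaT) * (2 * (P.Xmax * (2 * (P.n * P.f)))) + P.wmin)

/-- The true column values `Y` serve as a common reference: `G` is independent in their excess
graph, and the load each process computes for itself is within `η` of the load for `Y`. -/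
theorem sum_consensusWeight_loss_le (hε : 0 ≤ P.ε) (S : State P)
    (hw : ∀ i, 0 ≤ S.weight i ∧ S.weight i ≤ 1) (I : Finset ℕ)
    {hidden : Fin P.n → Finset (Fin P.n)} (hhidden : ∀ p, (hidden p).card ≤ P.f)
    {G : Finset (Fin P.n)}
    (hG : ∀ i ∈ G, ∀ j ∈ G,
      ∑ τ ∈ I, columnValue P (S.board τ i) * columnValue P (S.board τ j) ≤
        P.betaT + if i = j then (P.m * P.T : ℝ) else 0)
    {w' : Fin P.n → ℝ} (hw' : w' = consensusWeight P I S.weight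
      fun p τ i => columnValue P (S.viewColumn (hidden p) τ i)) :
    ∑ i ∈ G, (S.weight i - w' i) ≤ ∑ i ∈ Gᶜ, (S.weight i - w' i) + epochSlack P := by
  have hw0 : ∀ i, 0 ≤ S.weight i := fun i => (hw i).1
  set X : Fin P.n → ℕ → Fin P.n → ℝ := fun p τ i => columnValue P (S.viewColumn (hidden p) τ i)
  set Y : ℕ → Fin P.n → ℝ := fun τ i => columnValue P (S.board τ i)
  set η := 16 / (P.ε * P.f * P.alphaT) * (2 * (P.Xmax * (2 * (P.n * P.f)))) with hη
  have hα := P.alphaT_nonneg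
  have hXm := P.Xmax_nonneg
  have hη0 : 0 ≤ η := by positivity
  have hclose : ∀ p i, |load P I S.weight (X p) i - load P I S.weight Y i| ≤ η := by
    intro p i
    refine (abs_load_sub_le hε hw (fun _ _ => abs_columnValue_le _)
      (fun _ _ => abs_columnValue_le _) (sum_abs_view_sub_le S (hidden p) I) i).trans ?_
    have : ∑ i, (if i ∈ hidden p then (1 : ℝ) else 0) ≤ P.f := by
      rw [Finset.sum_boole, Finset.filter_mem_eq_inter, Finset.univ_inter]
      exact_mod_cast hhidden p
    rw [hη]
    gcongr
  have hb := fun i => consensusWeight_bounds hε hw0 I X i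
  rw [← hw'] at hb
  have h1 : ∑ i ∈ G, (S.weight i - w' i) ≤
      ∑ i ∈ G, load P I S.weight Y i + ∑ i ∈ G, (η + P.wmin) := by
    rw [← Finset.sum_add_distrib]
    refine Finset.sum_le_sum fun i _ => ?_
    have := (abs_le.1 (hclose i i)).2
    linarith [(hb i).2.2]
  have h2 : ∑ i ∈ Gᶜ, load P I S.weight Y i ≤
      ∑ i ∈ Gᶜ, (S.weight i - w' i) + ∑ i ∈ Gᶜ, (η + P.wmin) := by
    rw [← Finset.sum_add_distrib]
    refine Finset.sum_le_sum fun i _ => ?_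
    have := (abs_le.1 (hclose i i)).1
    linarith [(hb i).2.1, P.wmin_nonneg]
  have h3 := sum_load_le hε hw0 (I := I) (X := Y) (G := G) fun i hi j hj =>
    excessCap_eq_zero hw0 (hG i hi j hj)
  have h4 : ∑ i ∈ G, (η + P.wmin) + ∑ i ∈ Gᶜ, (η + P.wmin) = epochSlack P := by
    rw [Finset.sum_add_sum_compl, Finset.sum_const, Finset.card_univ, Fintype.card_fin,
      nsmul_eq_mul, hη, epochSlack]
  linarith

end ExcessGraph

/-! ### Deterministic consequences along a play -/

section Invariants

variable {P : Params}

theorem length_board_le (adv : Adversary P) (ω : ℕ → Bool) (s τ : ℕ) (i : Fin P.n) :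
    ((play P adv ω s).board τ i).length ≤ P.m := by
  induction s with
  | zero => simp [play, State.init]
  | succ s ih =>
    rw [play]
    set S := play P adv ω s
    have happ : ∀ j b, (S.board S.t j).length < P.m →
        ((S.append j b).board τ i).length ≤ P.m := by
      intro j b h
      simp only [State.append]
      split_ifs with h'
      · rw [h'.1, h'.2, List.length_append, List.length_singleton]
        omega
      · exact ih
    cases adv (List.ofFn fun r : Fin s => ω r) with
    | idle => exact ih
    | flip j => simp only [State.step]; split_ifs with h; exacts [happ _ _ h.2, ih]
    | write j b => simp only [State.step]; split_ifs with h; exacts [happ _ _ h.2, ih]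
    | corrupt j => simp only [State.step]; split_ifs; exacts [ih, ih]
    | complete hidden => simp only [State.step]; split_ifs; exacts [ih, ih]

theorem weight_mem_Icc (hε : 0 ≤ P.ε) (adv : Adversary P) (ω : ℕ → Bool) (s : ℕ) (i : Fin P.n) :
    0 ≤ (play P adv ω s).weight i ∧ (play P adv ω s).weight i ≤ 1 := by
  induction s generalizing i with
  | zero => simp [play, State.init]
  | succ s ih =>
    rw [play]
    set S := play P adv ω s
    cases adv (List.ofFn fun r : Fin s => ω r) with
    | idle => exact ih i
    | flip j => simp only [State.step]; split_ifs; exacts [ih i, ih i]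
    | write j b => simp only [State.step]; split_ifs; exacts [ih i, ih i]
    | corrupt j => simp only [State.step]; split_ifs; exacts [ih i, ih i]
    | complete hidden =>
      simp only [State.step]
      split_ifs
      · simp only [State.finish]
        split_ifs
        · have h0 : ∀ i, 0 ≤ S.weight i := fun i => (ih i).1
          have h := fun X => consensusWeight_bounds hε h0
            (Finset.Ico (S.t + 1 - P.T) (S.t + 1)) X i
          have h' := load_nonneg hε h0 (Finset.Ico (S.t + 1 - P.T) (S.t + 1))
          refine ⟨(h _).1, ?_⟩
          have h1 := (h fun p τ i => columnValue P (S.viewColumn (hidden p) τ i)).2.1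
          linarith [h' ((fun p τ i => columnValue P (S.viewColumn (hidden p) τ i)) i) i, (ih i).2]
        · exact ih i
      · exact ih i

/-- Every prefix of a column was the whole column at some earlier time, when its process was good
too. Hence the potential must be below `1` at all times, not just at the present one. -/
theorem abs_colSum_prefix_le {N : ℕ} (hm : 0 < P.m) (hL : 0 < P.c * Real.log P.n)
    {adv : Adversary P} {ω : ℕ → Bool} (hω : ∀ s, totalPotential N (play P adv ω s) < 1)
    {s : ℕ} {i : Fin P.n} (hi : i ∉ (play P adv ω s).bad) {τ : ℕ} (hτ : τ < N * P.T)
    {l : List Bool} (hl : l <+: (play P adv ω s).board τ i) : |colSum l| ≤ P.Xmax := by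
  induction s with
  | zero =>
    obtain rfl : l = [] := by simpa [play, State.init] using hl
    simpa [colSum] using P.Xmax_nonneg
  | succ s ih =>
    have hwhole := abs_colSum_le_Xmax hm hL (hω (s + 1)) hτ hi (length_board_le _ _ _ _ _)
    rw [play] at hi hl hwhole
    set S := play P adv ω s
    have happ : ∀ j b, i ∉ S.bad → l <+: (S.append j b).board τ i →
        |colSum ((S.append j b).board τ i)| ≤ P.Xmax → |colSum l| ≤ P.Xmax := by
      intro j b hi hl hwhole
      simp only [State.append] at hl hwhole
      split_ifs at hl hwhole with h
      · rcases List.prefix_concat_iff.1 hl with rfl | hl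
        · exact hwhole
        · exact ih hi hl
      · exact ih hi hl
    revert hi hl hwhole
    cases adv (List.ofFn fun r : Fin s => ω r) with
    | idle => exact fun hi hl _ => ih hi hl
    | flip j =>
      simp only [State.step]
      split_ifs
      · exact happ _ _
      · exact fun hi hl _ => ih hi hl
    | write j b =>
      simp only [State.step]
      split_ifs
      · exact happ _ _
      · exact fun hi hl _ => ih hi hl
    | corrupt j =>
      simp only [State.step]
      split_ifs
      · exact fun hi hl _ => ih (fun h => hi (Finset.mem_insert_of_mem h)) hl
      · exact fun hi hl _ => ih hi hl
    | complete hidden =>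
      simp only [State.step]
      split_ifs
      · exact fun hi hl _ => ih hi hl
      · exact fun hi hl _ => ih hi hl

/-- On the event that the potential stays below `1`, the good processes lose at most
`epochSlack P` more than the bad ones in each epoch. -/
theorem weightLossBound_of_totalPotential_lt {N : ℕ} (hε : 0 ≤ P.ε) (hm : 0 < P.m) (hT : 0 < P.T)
    (hL : 0 < P.c * Real.log P.n) {adv : Adversary P} {ω : ℕ → Bool}
    (hω : ∀ s, totalPotential N (play P adv ω s) < 1) (s : ℕ)
    (hs : (play P adv ω s).epoch ≤ N + 1) :
    (play P adv ω s).WeightLossBound (epochSlack P * (((play P adv ω s).epoch : ℝ) - 1)) := by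
  induction s with
  | zero => simp [play, State.init, State.WeightLossBound, State.epoch]
  | succ s ih =>
    have hw := weight_mem_Icc hε adv ω s
    have hlen := length_board_le adv ω s
    have htame := fun (i : Fin P.n) (hi : i ∉ (play P adv ω s).bad) τ (hτ : τ < N * P.T)
      (l : List Bool) => abs_colSum_prefix_le hm hL hω hi hτ (l := l)
    have hpot := hω s
    rw [play] at hs ⊢
    set S := play P adv ω s
    revert hs
    cases adv (List.ofFn fun r : Fin s => ω r) with
    | idle => exact ih
    | flip j => simp only [State.step]; split_ifs; exacts [ih, ih]
    | write j b => simp only [State.step]; split_ifs; exacts [ih, ih]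
    | corrupt j =>
      simp only [State.step]
      split_ifs
      · intro hs
        have h := ih hs
        have hnn : ∀ i, 0 ≤ 1 - S.weight i := fun i => by linarith [(hw i).2]
        -- Weights are at most `1`, so corrupting `j` transfers a nonnegative loss from the left
        -- side to the right.
        simp only [State.WeightLossBound, State.good, State.epoch] at h ⊢
        have h1 : ∑ i ∈ (insert j S.bad)ᶜ, (1 - S.weight i) ≤ ∑ i ∈ S.badᶜ, (1 - S.weight i) :=
          Finset.sum_le_sum_of_subset_of_nonneg
            (Finset.compl_subset_compl.2 (Finset.subset_insert _ _)) fun i _ _ => hnn i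
        have h2 : ∑ i ∈ S.bad, (1 - S.weight i) ≤ ∑ i ∈ insert j S.bad, (1 - S.weight i) :=
          Finset.sum_le_sum_of_subset_of_nonneg (Finset.subset_insert _ _) fun i _ _ => hnn i
        linarith
      · exact ih
    | complete hidden =>
      simp only [State.step]
      split_ifs with hrule
      swap; · exact ih
      intro hs
      by_cases hdvd : P.T ∣ S.t + 1
      -- The epoch that ends has index `κ + 1` and iterations `epochIter P κ`; only epochs up to `N`
      -- have to be controlled, whence the bound `N + 1` on the new index.
      · obtain ⟨k, hk⟩ := hdvd
        obtain ⟨κ, rfl⟩ : ∃ κ, k = κ + 1 := ⟨k - 1, by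
          have : k ≠ 0 := by rintro rfl; simp at hk
          omega⟩
        have hep' : (S.finish hidden).epoch = κ + 1 + 1 := by
          simp only [State.epoch, State.finish]
          rw [hk, Nat.mul_div_cancel_left _ hT]
        have hep : S.epoch = κ + 1 := by
          simp only [State.epoch]
          have := Nat.succ_div_of_dvd (Dvd.intro _ hk.symm)
          rw [hk, Nat.mul_div_cancel_left _ hT] at this
          omega
        have hκ : κ < N := by omega
        have hI : Finset.Ico (S.t + 1 - P.T) (S.t + 1) = epochIter P κ := by
          rw [hk, epochIter, mul_comm P.T, add_mul, one_mul, Nat.add_sub_cancel]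
        have hτN : ∀ τ ∈ epochIter P κ, τ < N * P.T := fun τ hτ =>
          (Finset.mem_Ico.1 hτ).2.trans_le (Nat.mul_le_mul_right _ hκ)
        have hweight : (S.finish hidden).weight = consensusWeight P (epochIter P κ) S.weight
            fun p τ i => columnValue P (S.viewColumn (hidden p) τ i) := by
          rw [← hI]
          exact if_pos (Dvd.intro _ hk.symm)
        have hloss := sum_consensusWeight_loss_le hε S hw (epochIter P κ) hrule.2 (G := S.good)
          (fun i hi j hj => by
            simp only [State.good, Finset.mem_compl] at hi hj
            have htame' : ∀ τ ∈ epochIter P κ, S.board τ ∈ tameRows P i j := fun τ hτ l hl =>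
              hl.elim (htame i hi τ (hτN τ hτ) l) (htame j hj τ (hτN τ hτ) l)
            refine (Finset.sum_congr rfl fun τ hτ => ?_).trans_le
              (sum_colSum_mul_le hm hT hL hpot hκ hi hj htame' hlen)
            rw [columnValue_of_abs_le (htame' τ hτ _ (Or.inl List.prefix_rfl)),
              columnValue_of_abs_le (htame' τ hτ _ (Or.inr List.prefix_rfl))]) hweight
        have h := ih (by omega)
        simp only [State.WeightLossBound] at h ⊢
        rw [hep']
        rw [hep] at h
        have hgood : (S.finish hidden).good = S.good := rfl
        have hbad : (S.finish hidden).bad = S.bad := rfl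
        have hcompl : S.goodᶜ = S.bad := compl_compl _
        rw [hgood, hbad]
        rw [hcompl] at hloss
        simp only [Finset.sum_sub_distrib] at h hloss ⊢
        push_cast at h ⊢
        linarith
      · have hep : (S.finish hidden).epoch = S.epoch := by
          simp only [State.epoch, State.finish]
          rw [Nat.succ_div_of_not_dvd hdvd]
        have hwt : (S.finish hidden).weight = S.weight := if_neg hdvd
        rw [hep] at hs ⊢
        have h := ih hs
        simp only [State.WeightLossBound] at h ⊢
        rw [hwt]
        exact h

end Invariants

/-! ### Parameter estimates -/

section Parameters

open Filter Topology

variable {P : Params}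

theorem epochSlack_le {m₁ T₁ : ℝ} (hm₁ : 0 < m₁) (hT₁ : 0 < T₁) (hε : 0 < P.ε) (hf : 0 < P.f)
    (hn : 0 < P.n) (hc : 0 ≤ P.c) (hlog : 1 ≤ Real.log P.n)
    (hm : m₁ * (P.n / P.ε ^ 2) ≤ P.m)
    (hT : T₁ * (P.n ^ 2 * Real.log P.n ^ 3 / P.ε ^ 2) ≤ P.T)
    (hbig : 128 * √P.c ≤ √m₁ * T₁ * Real.log P.n) (hbig' : 2 ≤ T₁ * Real.log P.n) :
    epochSlack P ≤ P.ε ^ 2 / √P.n := by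
  have hn' : (0 : ℝ) < P.n := by exact_mod_cast hn
  have hf' : (0 : ℝ) < P.f := by exact_mod_cast hf
  have hm0 : (0 : ℝ) < P.m := lt_of_lt_of_le (by positivity) hm
  have hT0 : (0 : ℝ) < P.T := lt_of_lt_of_le (by positivity) hT
  have hlog0 : 0 < Real.log P.n := by linarith
  have hα : (P.m * P.T : ℝ) ≤ P.alphaT := by
    rw [Params.alphaT_eq]; linarith [P.betaT_nonneg]
  have hα0 : 0 < P.alphaT := lt_of_lt_of_le (by positivity) hα
  have hX : P.Xmax = √P.c * √P.m * √(Real.log P.n) := by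
    rw [Params.Xmax, Real.sqrt_mul (by positivity), Real.sqrt_mul hc]
  set q := √(P.n : ℝ) with hq
  set r := √(P.m : ℝ) with hr
  set h := √(Real.log P.n) with hh
  have hq0 : 0 < q := Real.sqrt_pos.2 hn'
  have hr0 : 0 < r := Real.sqrt_pos.2 hm0
  have hq2 : (P.n : ℝ) = q ^ 2 := (Real.sq_sqrt hn'.le).symm
  have hr2 : (P.m : ℝ) = r ^ 2 := (Real.sq_sqrt hm0.le).symm
  have hh2 : Real.log P.n = h ^ 2 := (Real.sq_sqrt hlog0.le).symm
  have hh1 : 1 ≤ h := Real.one_le_sqrt.2 hlog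
  -- In terms of `q = √n`, `r = √m` and `h = √(ln n)`, the lower bounds on `m` and `T` become
  -- monomial inequalities. The view error and the rounding error each get half of `ε² / √n`.
  have hrq : √m₁ * q ≤ P.ε * r := by
    rw [← Real.sqrt_sq hε.le, ← Real.sqrt_mul hm₁.le, ← Real.sqrt_mul (by positivity)]
    refine Real.sqrt_le_sqrt ?_
    rw [← mul_div_assoc, div_le_iff₀ (by positivity)] at hm
    linarith
  have hTq : T₁ * q ^ 4 * h ^ 6 ≤ P.ε ^ 2 * P.T := by
    rw [← mul_div_assoc, div_le_iff₀ (by positivity)] at hT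
    have h1 : (P.n : ℝ) ^ 2 = q ^ 4 := by rw [hq2]; ring
    have h2 : Real.log P.n ^ 3 = h ^ 6 := by rw [hh2]; ring
    rw [h1, h2] at hT
    linarith
  have hpow : h ≤ h ^ 4 := le_self_pow₀ hh1 (by norm_num)
  rw [hh2] at hbig hbig'
  have hfirst : P.n * (16 / (P.ε * P.f * P.alphaT) * (2 * (P.Xmax * (2 * (P.n * P.f))))) ≤
      P.ε ^ 2 / (2 * q) := by
    calc P.n * (16 / (P.ε * P.f * P.alphaT) * (2 * (P.Xmax * (2 * (P.n * P.f)))))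
        = 64 * P.n ^ 2 * P.Xmax / (P.ε * P.alphaT) := by field_simp; ring
      _ ≤ 64 * P.n ^ 2 * P.Xmax / (P.ε * (P.m * P.T)) := by
        have := P.Xmax_nonneg
        gcongr
      _ ≤ P.ε ^ 2 / (2 * q) := by
        rw [div_le_div_iff₀ (by positivity) (by positivity), hX, hq2, hr2]
        have h1 : 128 * √P.c * (q ^ 5 * h) ≤ √m₁ * T₁ * h ^ 2 * (q ^ 5 * h ^ 4) := by gcongr
        have h2 : (√m₁ * q) * (T₁ * q ^ 4 * h ^ 6) ≤ (P.ε * r) * (P.ε ^ 2 * P.T) := by gcongr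
        have h3 : 128 * √P.c * (q ^ 5 * h) * r ≤ (P.ε * r) * (P.ε ^ 2 * P.T) * r :=
          mul_le_mul_of_nonneg_right (by linarith) hr0.le
        linarith
  have hsecond : P.n * P.wmin ≤ P.ε ^ 2 / (2 * q) := by
    rw [Params.wmin, Real.sqrt_mul hn'.le, ← hq, ← hh, ← mul_div_assoc,
      div_le_div_iff₀ hT0 (by positivity), hq2]
    have h1 : 2 * (q ^ 4 * h) ≤ T₁ * h ^ 2 * (q ^ 4 * h ^ 4) := by gcongr
    linarith
  rw [epochSlack, mul_add]
  have : P.ε ^ 2 / q = P.ε ^ 2 / (2 * q) + P.ε ^ 2 / (2 * q) := by field_simp; ring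
  linarith

theorem totalPotential_init_le_rpow {T₂ : ℝ} (hε : 0 < P.ε) (hf : (P.n : ℝ) = (4 + P.ε) * P.f)
    (hn : 3 ≤ P.n) (hT₂ : T₂ ≤ P.n) (hT₂' : 0 < T₂) (hc : 44 ≤ P.c) (hlog : 1 ≤ Real.log P.n)
    (hT : P.T ≤ T₂ * (P.n ^ 2 * Real.log P.n ^ 3 / P.ε ^ 2)) :
    totalPotential (3 * P.f) (State.init P) ≤ (P.n : ℝ) ^ (-(1 / 4 * P.c)) := by
  have hn' : (3 : ℝ) ≤ P.n := by exact_mod_cast hn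
  have hn0 : (0 : ℝ) < P.n := by linarith
  have hf1 : (0 : ℝ) ≤ P.f := Nat.cast_nonneg _
  have hfn : 3 * (P.f : ℝ) ≤ P.n := by rw [hf]; nlinarith
  -- `ε f = n - 4 f` is a positive integer, hence at least `1`. So `1 / ε` is at most `n`, and `T`
  -- is polynomial in `n`.
  have hεn : 1 ≤ P.ε * P.n := by
    have h1 : P.ε * P.f = P.n - 4 * P.f := by rw [hf]; ring
    have hf0 : (0 : ℝ) < P.f := by
      rcases hf1.lt_or_eq with h | h
      · exact h
      · rw [← h] at hf; linarith
    have h2 : (0 : ℝ) < (P.n : ℝ) - 4 * P.f := by rw [← h1]; positivity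
    have h3 : 4 * P.f < P.n := by
      have : (4 * P.f : ℝ) < P.n := by linarith
      exact_mod_cast this
    have h4 : (4 * P.f + 1 : ℝ) ≤ P.n := by exact_mod_cast h3
    nlinarith
  have hlogn : Real.log P.n ≤ P.n := (Real.log_le_sub_one_of_pos hn0).trans (by linarith)
  have hTn : (P.T : ℝ) ≤ (P.n : ℝ) ^ 8 := by
    have h1 : (1 : ℝ) / P.ε ^ 2 ≤ (P.n : ℝ) ^ 2 := by
      rw [div_le_iff₀ (by positivity), ← mul_pow, mul_comm]
      exact one_le_pow₀ hεn
    calc (P.T : ℝ) ≤ T₂ * (P.n ^ 2 * Real.log P.n ^ 3 / P.ε ^ 2) := hT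
      _ = T₂ * (P.n ^ 2 * Real.log P.n ^ 3 * (1 / P.ε ^ 2)) := by ring
      _ ≤ P.n * (P.n ^ 2 * P.n ^ 3 * P.n ^ 2) := by gcongr
      _ = (P.n : ℝ) ^ 8 := by ring
  set L := P.c * Real.log P.n with hLdef
  have hL : 44 ≤ L := by nlinarith
  have hexp : Real.exp (-(L ^ 2 / 8)) ≤ Real.exp (-(L / 2)) := by
    rw [Real.exp_le_exp]; nlinarith
  have hrpow : Real.exp (-(L / 2)) = (P.n : ℝ) ^ (-(P.c / 2)) := by
    rw [Real.rpow_def_of_pos hn0]; congr 1; rw [hLdef]; ring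
  refine (totalPotential_init_le _).trans ?_
  push_cast
  rw [← hLdef]
  calc 2 * (3 * (P.f : ℝ)) * P.T * P.n * Real.exp (-(L / 2)) +
        3 * P.f * P.n ^ 2 * Real.exp (-(L ^ 2 / 8))
      ≤ 2 * P.n * P.n ^ 8 * P.n * Real.exp (-(L / 2)) +
        P.n * P.n ^ 2 * Real.exp (-(L / 2)) := by gcongr
    _ ≤ (P.n : ℝ) ^ 11 * Real.exp (-(L / 2)) := by
      rw [← add_mul]
      refine mul_le_mul_of_nonneg_right ?_ (Real.exp_nonneg _)
      have h3 : (P.n : ℝ) ^ 3 ≤ P.n ^ 10 := pow_le_pow_right₀ (by linarith) (by norm_num)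
      have h11 : 3 * (P.n : ℝ) ^ 10 ≤ P.n * P.n ^ 10 :=
        mul_le_mul_of_nonneg_right hn' (by positivity)
      calc (2 * P.n * P.n ^ 8 * P.n + P.n * P.n ^ 2 : ℝ) =
            2 * (P.n : ℝ) ^ 10 + (P.n : ℝ) ^ 3 := by ring
        _ ≤ (P.n : ℝ) * (P.n : ℝ) ^ 10 := by linarith
        _ = (P.n : ℝ) ^ 11 := by ring
    _ = (P.n : ℝ) ^ (11 + -(P.c / 2)) := by
      rw [hrpow, Real.rpow_add hn0]
      norm_cast
    -- `11 - c / 2 ≤ -c / 4` is where `c ≥ 44` is used.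
    _ ≤ _ := Real.rpow_le_rpow_of_exponent_le (by linarith) (by linarith)

theorem State.WeightLossBound.mono {S : State P} {x y : ℝ} (h : S.WeightLossBound x)
    (hxy : x ≤ y) : S.WeightLossBound y :=
  le_trans h (by linarith)

theorem eventually_large (c m₁ T₁ T₂ : ℝ) (hm₁ : 0 < m₁) (hT₁ : 0 < T₁) :
    ∀ᶠ n : ℕ in atTop, 400 ≤ n ∧ T₂ ≤ n ∧ 1 ≤ Real.log n ∧
      128 * √c ≤ √m₁ * T₁ * Real.log n ∧ 2 ≤ T₁ * Real.log n := by
  have hlog : Tendsto (fun n : ℕ => Real.log n) atTop atTop :=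
    Real.tendsto_log_atTop.comp tendsto_natCast_atTop_atTop
  exact (eventually_ge_atTop 400).and <| (tendsto_natCast_atTop_atTop.eventually_ge_atTop T₂).and <|
    (hlog.eventually_ge_atTop 1).and <|
    ((hlog.const_mul_atTop (by positivity)).eventually_ge_atTop _).and <|
    (hlog.const_mul_atTop hT₁).eventually_ge_atTop _

end Parameters

end CoinGame

end

/-! ### The main theorem -/

theorem mainTheorem5 :
    ∃ a : ℝ, 0 < a ∧ ∃ c₀ : ℝ, 0 < c₀ ∧ ∀ c : ℝ, c₀ ≤ c →
    ∀ m₁ m₂ T₁ T₂ : ℝ, 0 < m₁ → 0 < m₂ → 0 < T₁ → 0 < T₂ →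
    ∃ n₀ : ℕ, ∀ (n f m T : ℕ) (ε : ℝ), n₀ ≤ n → 0 < ε → (n : ℝ) = (4 + ε) * f →
      m₁ * (n / ε ^ 2) ≤ m → m ≤ m₂ * (n / ε ^ 2) →
      T₁ * (n ^ 2 * Real.log n ^ 3 / ε ^ 2) ≤ T → T ≤ T₂ * (n ^ 2 * Real.log n ^ 3 / ε ^ 2) →
      ∀ adv : CoinGame.Adversary ⟨n, f, m, T, ε, c⟩,
        CoinGame.coinMeasure
          {ω | ¬ ∀ s : ℕ,
            ((CoinGame.play ⟨n, f, m, T, ε, c⟩ adv ω s).epoch : ℝ) ≤ 5 / 2 * f →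
              (CoinGame.play ⟨n, f, m, T, ε, c⟩ adv ω s).WeightLossBound
                (ε ^ 2 / √(n : ℝ) *
                  (((CoinGame.play ⟨n, f, m, T, ε, c⟩ adv ω s).epoch : ℝ) - 1)) ∧
              (CoinGame.play ⟨n, f, m, T, ε, c⟩ adv ω s).WeightInvariant}
          ≤ ENNReal.ofReal ((n : ℝ) ^ (-(a * c))) := by
  refine ⟨1 / 4, by norm_num, 44, by norm_num, fun c hc m₁ m₂ T₁ T₂ hm₁ _ hT₁ hT₂ => ?_⟩
  obtain ⟨n₀, hn₀⟩ := Filter.eventually_atTop.1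
    (CoinGame.eventually_large c m₁ T₁ T₂ hm₁ hT₁)
  refine ⟨n₀, fun n f m T ε hn hε hf hm _ hT hT' => ?_⟩
  obtain ⟨h400, hT₂n, hlog, hbig, hbig'⟩ := hn₀ n hn
  have hn0 : (400 : ℝ) ≤ n := by exact_mod_cast h400
  have hf0 : 0 < f := by
    rcases Nat.eq_zero_or_pos f with rfl | h
    · rw [Nat.cast_zero, mul_zero] at hf
      linarith
    · exact h
  have hm0 : 0 < m := by
    have : (0 : ℝ) < m := lt_of_lt_of_le (by positivity) hm
    exact_mod_cast this
  have hT0 : 0 < T := by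
    have : (0 : ℝ) < T := lt_of_lt_of_le (by positivity) hT
    exact_mod_cast this
  set P : CoinGame.Params := ⟨n, f, m, T, ε, c⟩ with hP
  intro adv
  have hslack : CoinGame.epochSlack P ≤ ε ^ 2 / √(n : ℝ) :=
    CoinGame.epochSlack_le (P := P) hm₁ hT₁ hε hf0 (by simp only [hP]; omega)
      (by simp only [hP]; linarith) hlog hm hT hbig hbig'
  -- A failure forces the potential of the first `3 f` epochs, an integer count covering `2.5 f`, to
  -- reach `1` at some time.
  refine le_trans (MeasureTheory.measure_mono ?_)
    ((CoinGame.coinMeasure_exists_one_le_potential adv (CoinGame.totalPotential_nonneg (3 * f))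
      (CoinGame.isPotential_totalPotential (3 * f))).trans (ENNReal.ofReal_le_ofReal
        (CoinGame.totalPotential_init_le_rpow (P := P) hε hf (by simp only [hP]; omega) hT₂n hT₂ hc
          hlog hT')))
  intro ω hω
  by_contra hcon
  simp only [Set.mem_ofPred_eq, not_exists, not_le] at hcon
  refine hω fun s hs => ?_
  have hN : (CoinGame.play P adv ω s).epoch ≤ 3 * f + 1 := by
    have : ((CoinGame.play P adv ω s).epoch : ℝ) ≤ 3 * f + 1 := by
      linarith [(Nat.cast_nonneg f : (0 : ℝ) ≤ f)]
    exact_mod_cast this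
  have hk : (1 : ℝ) ≤ (CoinGame.play P adv ω s).epoch := by
    exact_mod_cast Nat.le_add_left 1 _
  have hbound := (CoinGame.weightLossBound_of_totalPotential_lt (P := P) hε.le hm0 hT0
    (mul_pos (by simp only [hP]; linarith) (lt_of_lt_of_le one_pos hlog)) hcon s hN).mono
    (mul_le_mul_of_nonneg_right hslack (sub_nonneg.2 hk))
  refine ⟨hbound, hbound.mono ?_⟩
  -- `n ≥ 400` is chosen for this: `(1 / 20) * (5 / 2) = 1 / 8`.
  have hsqrt : 20 ≤ √(n : ℝ) := Real.le_sqrt_of_sq_le (by linarith)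
  change _ ≤ ε ^ 2 * f / 8
  calc ε ^ 2 / √(n : ℝ) * (((CoinGame.play P adv ω s).epoch : ℝ) - 1)
      ≤ ε ^ 2 / 20 * (5 / 2 * f) := by
        gcongr
        linarith
    _ = ε ^ 2 * f / 8 := by ring
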